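/- Let $(\Lambda,\mu)$ be a $\sigma$-finite measure space and $N\ge 0$ an integer. "Quaternion" means complexified quaternion $q=s+x\mathbf i+y\mathbf j+z\mathbf k$ with $s,x,y,z\in\mathbb C$, and $q^{*}=s-x\mathbf i-y\mathbf j-z\mathbf k$ (the coefficients are not conjugated). For an $n\times n$ quaternion matrix $X$, the Moore--Dyson determinant is $$\mathrm{Det}_M(X)=\sum_{\sigma\in S_n}\varepsilon(\sigma)\,(X_{n_1i_2}X_{i_2i_3}\cdots X_{i_sn_1})\cdots(X_{n_rk_2}X_{k_2k_3}\cdots X_{k_ln_r}),$$ where $\sigma=(n_1i_2\ldots i_s)\cdots(n_rk_2\ldots k_l)$ is the decomposition of $\sigma$ into cycles (fixed points included), each cycle starts with its largest element, $n_1>n_2>\dots>n_r$, and $\varepsilon(\sigma)$ is the sign of $\sigma$. A random point field on $\Lambda$ is a probability measure $\mathbb P$ on the space of countable configurations (subsets) of $\Lambda$, equipped with the $\sigma$-algebra generated by the counts $\#(A)$ of points in measurable sets $A$. A function $R_n:\Lambda^n\to[0,\infty)$, integrable over $B^n$ for every measurable $B$ with $\mu(B)<\infty$, is its $n$-point correlation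 function if for all pairwise disjoint measurable $A_1,\dots,A_m$ and all integers $k_i\ge 0$ with $\sum_i k_i=n$, $$\mathbb E\prod_{i=1}^m\#(A_i)(\#(A_i)-1)\cdots(\#(A_i)-k_i+1)=\int_{A_1^{k_1}\times\cdots\times A_m^{k_m}}R_n\,d\mu^{\otimes n}.$$ The field is Pfaffian (symplectic determinantal) with kernel $K$ if $K(y,x)=K(x,y)^{*}$ for all $x,y\in\Lambda$ and, for every $n\ge 1$, the function $\mathrm{Det}_M(K(x_i,x_j))_{1\le i,j\le n}$ is an $n$-point correlation function of the field. **Proposition.** Let $u_1,\dots,u_N:\Lambda\to\mathbb Q_{\mathbb C}$ be measurable quaternion functions that are orthonormal: for all $k,l$ the function $u_k^{*}u_l$ is integrable and $\int_\Lambda u_k^{*}(x)u_l(x)\,d\mu(x)=\delta_{kl}$. Let $K_N(x,y)=\sum_{k=1}^N u_k(x)u_k^{*}(y)$, and assume that $K_N$ is positive, that is, $\mathrm{Det}_M(K_N(x_i,x_j))_{1\le i,j\le m}$ is a nonnegative real scalar for all $m\ge 1$ and all $x_1,\dots,x_m\in\Lambda$. Then there exists a Pfaffian (symplectic determinantal)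 random point field on $\Lambda$ with kernel $K_N$, and every Pfaffian random point field with kernel $K_N$ has exactly $N$ points almost surely. -/

import Mathlib

open MeasureTheory
open scoped ENNReal

/-- Complexified quaternions `s + x i + y j + z k` with `s, x, y, z : ℂ`.  Here `star` is the
quaternion conjugation `s - x i - y j - z k`; it does *not* conjugate the complex coefficients. -/
abbrev CQuat : Type := Quaternion ℂ

namespace CQuat

/-- The scalar complexified quaternion with the real value `r`. -/
noncomputable def ofReal (r : ℝ) : CQuat := ((r : ℂ) : Quaternion ℂ)

variable {Λ : Type*} [MeasurableSpace Λ]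

/-- Measurability of a quaternion function: all four complex coordinates are measurable. -/
structure IsMeasurable (f : Λ → CQuat) : Prop where
  re : Measurable fun x => (f x).re
  imI : Measurable fun x => (f x).imI
  imJ : Measurable fun x => (f x).imJ
  imK : Measurable fun x => (f x).imK

/-- Integrability of a quaternion function: all four complex coordinates are integrable. -/
structure IsIntegrable (f : Λ → CQuat) (μ : Measure Λ) : Prop where
  re : Integrable (fun x => (f x).re) μ
  imI : Integrable (fun x => (f x).imI) μ
  imJ : Integrable (fun x => (f x).imJ) μ
  imK : Integrable (fun x => (f x).imK) μ

/-- The coordinatewise integral of a quaternion function. -/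
noncomputable def integral (f : Λ → CQuat) (μ : Measure Λ) : CQuat :=
  ⟨∫ x, (f x).re ∂μ, ∫ x, (f x).imI ∂μ, ∫ x, (f x).imJ ∂μ, ∫ x, (f x).imK ∂μ⟩

/-- Orthonormal system of quaternion functions: `∫ u_k^* u_l dμ = δ_{kl}`, where the integrals
exist. -/
structure IsOrthonormal {ι : Type*} [DecidableEq ι] (u : ι → Λ → CQuat) (μ : Measure Λ) :
    Prop where
  measurable : ∀ k, IsMeasurable (u k)
  integrable : ∀ k l, IsIntegrable (fun x => star (u k x) * u l x) μ
  integral_eq : ∀ k l, integral (fun x => star (u k x) * u l x) μ = if k = l then 1 else 0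

end CQuat

/-! ### The Moore–Dyson determinant -/

section MooreDyson

variable {n : ℕ}

/-- The ordered product `X_{a, σ a} X_{σ a, σ² a} ⋯ X_{σ^{s-1} a, a}` along the cycle of `σ` that
contains `a` (`s` is the length of the cycle), starting at `a`. -/
noncomputable def mooreCycleProd (X : Matrix (Fin n) (Fin n) CQuat) (σ : Equiv.Perm (Fin n))
    (a : Fin n) : CQuat :=
  ((List.range (Function.minimalPeriod σ a)).map fun t => X ((σ ^ t) a) ((σ ^ (t + 1)) a)).prod

/-- The largest elements of the cycles of `σ` (fixed points are cycles of length one), in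
decreasing order. -/
def mooreLeaders (σ : Equiv.Perm (Fin n)) : List (Fin n) :=
  (List.finRange n).reverse.filter fun a => decide (∀ b, σ.SameCycle a b → b ≤ a)

/-- The Moore–Dyson determinant: the sum over all permutations of the signed product of the cycle
products, each cycle starting with its largest element and the cycles being ordered by decreasing
largest elements. -/
noncomputable def mooreDet (X : Matrix (Fin n) (Fin n) CQuat) : CQuat :=
  ∑ σ : Equiv.Perm (Fin n),
    (Equiv.Perm.sign σ : ℤ) • ((mooreLeaders σ).map (mooreCycleProd X σ)).prod

end MooreDyson

/-! ### Quaternion kernels -/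

section Kernel

variable {Λ : Type*}

/-- The matrix `(K (x_i, x_j))_{i,j}`. -/
def kernelMatrix (K : Λ → Λ → CQuat) {m : ℕ} (x : Fin m → Λ) : Matrix (Fin m) (Fin m) CQuat :=
  Matrix.of fun i j => K (x i) (x j)

/-- Self-dual kernels: `K (y, x) = K (x, y)^*`. -/
def IsSelfDualKernel (K : Λ → Λ → CQuat) : Prop :=
  ∀ x y, K y x = star (K x y)

/-- Positive kernels: every Moore–Dyson determinant `Det_M (K (x_i, x_j))`, of any size `m ≥ 1`,
is (a scalar quaternion with) a nonnegative real value. -/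
def IsPositiveKernel (K : Λ → Λ → CQuat) : Prop :=
  ∀ m : ℕ, 1 ≤ m → ∀ x : Fin m → Λ,
    ∃ r : ℝ, 0 ≤ r ∧ mooreDet (kernelMatrix K x) = CQuat.ofReal r

/-- The kernel `K_N (x, y) = ∑_k u_k (x) u_k^* (y)`. -/
noncomputable def projectionKernel {N : ℕ} (u : Fin N → Λ → CQuat) : Λ → Λ → CQuat :=
  fun x y => ∑ k, u k x * star (u k y)

end Kernel

/-! ### Random point fields -/

/-- The space of countable configurations of (distinct) points of `Λ`. -/
def PointConfiguration (Λ : Type*) : Type _ := {S : Set Λ // S.Countable}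

namespace PointConfiguration

variable {Λ : Type*}

/-- `S.count A` is the number `#(A)` of points of the configuration `S` in the set `A`. -/
noncomputable def count (S : PointConfiguration Λ) (A : Set Λ) : ℕ∞ := (S.1 ∩ A).encard

/-- The `σ`-algebra on the space of configurations generated by the counts `#(A)` of the
measurable sets `A`. -/
instance [MeasurableSpace Λ] : MeasurableSpace (PointConfiguration Λ) :=
  MeasurableSpace.generateFrom
    {E | ∃ A : Set Λ, MeasurableSet A ∧ ∃ c : ℕ∞, E = {S : PointConfiguration Λ | S.count A = c}}

end PointConfiguration

/-- The falling factorial `c (c - 1) ⋯ (c - k + 1)`; it is `⊤` for `c = ⊤` and `k ≥ 1`. -/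
noncomputable def fallingFactorial (c : ℕ∞) (k : ℕ) : ℕ∞ :=
  ∏ j ∈ Finset.range k, (c - (j : ℕ∞))

section PointField

variable {Λ : Type*}

/-- The product set `A_1^{k_1} × ⋯ × A_m^{k_m}` in `Λ^n`, where `n = k_1 + ⋯ + k_m`: the first
`k_1` coordinates lie in `A_1`, the next `k_2` coordinates in `A_2`, and so on. -/
def blockSet {m n : ℕ} (A : Fin m → Set Λ) (k : Fin m → ℕ) (hk : ∑ i, k i = n) :
    Set (Fin n → Λ) :=
  {x | ∀ (i : Fin m) (j : Fin (k i)), x (Fin.cast hk (finSigmaFinEquiv ⟨i, j⟩)) ∈ A i}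

variable [MeasurableSpace Λ]

/-- `R` is an `n`-point correlation function, with respect to `μ`, of the random point field with
law `P`.  Local integrability is required in the strong form of integrability over `B^n` for all
measurable `B` of finite measure, so that no topology on `Λ` is needed. -/
structure IsCorrelationFunction (μ : Measure Λ) (P : Measure (PointConfiguration Λ)) (n : ℕ)
    (R : (Fin n → Λ) → ℝ) : Prop where
  nonneg : ∀ x, 0 ≤ R x
  integrableOn : ∀ B : Set Λ, MeasurableSet B → μ B < ∞ →
    IntegrableOn R (Set.univ.pi fun _ => B) (Measure.pi fun _ => μ)
  expectation_eq : ∀ (m : ℕ) (A : Fin m → Set Λ) (k : Fin m → ℕ) (hk : ∑ i, k i = n),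
    (∀ i, MeasurableSet (A i)) → Pairwise (fun i j => Disjoint (A i) (A j)) →
    ∫⁻ S, ((∏ i, fallingFactorial (S.count (A i)) (k i) : ℕ∞) : ℝ≥0∞) ∂P =
      ∫⁻ x in blockSet A k hk, ENNReal.ofReal (R x) ∂(Measure.pi fun _ => μ)

/-- The probability measure `P` on the space of configurations is a Pfaffian (symplectic
determinantal) random point field with kernel `K`, with respect to the background measure `μ`. -/
structure IsPfaffianPointField (μ : Measure Λ) (K : Λ → Λ → CQuat)
    (P : Measure (PointConfiguration Λ)) : Prop where
  isProbabilityMeasure : IsProbabilityMeasure P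
  selfDual : IsSelfDualKernel K
  correlation : ∀ m : ℕ, 1 ≤ m → ∃ R : (Fin m → Λ) → ℝ,
    IsCorrelationFunction μ P m R ∧
      ∀ x, mooreDet (kernelMatrix K x) = CQuat.ofReal (R x)

end PointField

/-! ### Reversing one cycle of a permutation -/

section RevCycle

open Equiv Equiv.Perm

variable {I : Type*} [Fintype I] [DecidableEq I]

/-! For a self-dual matrix, reversing a cycle conjugates its cycle product, so averaging over
reversals replaces each cycle product by its scalar part, half a trace of `2 × 2` matrices. The
Moore–Dyson determinant becomes `cycleExpansion`, a signed sum of products of half-traces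
(`mooreDet_eq_cycleExpansion`). The number of cycles is never computed: `cycleWeight` is an inverse
loop sum of identity matrices, so facts about loop sums also control the weights.

For the kernel `K_N`, cyclicity of the trace moves the two factors at each point together
(`loopSum_mul_comm`). Each matrix then depends on one point only, integrals over boxes factor, and
orthonormality says that the Gram matrix integrates to `1`. Deleting a point that carries the
identity multiplies the expansion by `N` minus the number of remaining points
(`cycleExpansion_option`). Hence `R_n` has total mass `N (N - 1) ⋯ (N - n + 1)`, and integrating `N
- n` variables out of `R_N` gives `(N - n)! R_n` (`lintegral_selected`).

Existence: `R_N / N!` is a probability density on `Λ^N`; forgetting labels gives the field. The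
points are distinct because the expansion vanishes when two rows agree (`cycleExpansion_eq_zero`),
so falling factorials of counts enumerate injective choices of labels. Number of points: the
factorial moment of order `N + 1` is zero, so there are at most `N` points, and the mean is `N`. -/

/-- The permutation `σ` with the cycle through `a` reversed. -/
def revCycle (σ : Perm I) (a : I) : Perm I :=
  σ * ((σ.cycleOf a)⁻¹ * (σ.cycleOf a)⁻¹)

theorem commute_cycleOf_inv_mul_inv (σ : Perm I) (a : I) :
    Commute σ ((σ.cycleOf a)⁻¹ * (σ.cycleOf a)⁻¹) := by
  have h : Commute σ (σ.cycleOf a) := by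
    ext x
    simp only [Perm.mul_apply, cycleOf_apply, sameCycle_apply_right]
    split_ifs <;> rfl
  exact h.inv_right.mul_right h.inv_right

/-- On the cycle of `a`, the second factor acts as `σ⁻²`, leaving `σ⁻¹`. Integer powers are kept
because they also determine the cycle partition. -/
theorem revCycle_zpow_apply_of_sameCycle {σ : Perm I} {a x : I} (h : σ.SameCycle a x) (n : ℤ) :
    ((revCycle σ a) ^ n) x = (σ ^ (-n)) x := by
  rw [revCycle, (commute_cycleOf_inv_mul_inv σ a).mul_zpow, ← sq, ← zpow_natCast, ← zpow_mul,
    h.cycleOf_eq, inv_zpow', Perm.mul_apply, cycleOf_zpow_apply_self, ← Perm.mul_apply, ← zpow_add]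
  congr 2
  push_cast
  ring

theorem revCycle_zpow_apply_of_not_sameCycle {σ : Perm I} {a x : I} (h : ¬ σ.SameCycle a x)
    (n : ℤ) : ((revCycle σ a) ^ n) x = (σ ^ n) x := by
  have hx : ((σ.cycleOf a)⁻¹ * (σ.cycleOf a)⁻¹) x = x := by
    have : (σ.cycleOf a)⁻¹ x = x := by
      rw [inv_eq_iff_eq, cycleOf_apply, if_neg h]
    rw [mul_apply, this, this]
  rw [revCycle, (commute_cycleOf_inv_mul_inv σ a).mul_zpow, mul_apply, zpow_apply_eq_self_of_apply_eq_self hx]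

theorem revCycle_apply (σ : Perm I) (a x : I) :
    revCycle σ a x = if σ.SameCycle a x then σ⁻¹ x else σ x := by
  split_ifs with h
  · simpa using revCycle_zpow_apply_of_sameCycle h 1
  · simpa using revCycle_zpow_apply_of_not_sameCycle h 1

theorem sameCycle_revCycle_iff {σ : Perm I} {a x y : I} :
    (revCycle σ a).SameCycle x y ↔ σ.SameCycle x y := by
  by_cases h : σ.SameCycle a x
  · constructor
    · rintro ⟨n, hn⟩
      exact ⟨-n, by rw [← hn, revCycle_zpow_apply_of_sameCycle h]⟩
    · rintro ⟨n, hn⟩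
      exact ⟨-n, by rw [← hn, revCycle_zpow_apply_of_sameCycle h, neg_neg]⟩
  · constructor
    · rintro ⟨n, hn⟩
      exact ⟨n, by rw [← hn, revCycle_zpow_apply_of_not_sameCycle h]⟩
    · rintro ⟨n, hn⟩
      exact ⟨n, by rw [← hn, revCycle_zpow_apply_of_not_sameCycle h]⟩

theorem revCycle_inv_apply (σ : Perm I) (a x : I) :
    (revCycle σ a)⁻¹ x = if σ.SameCycle a x then σ x else σ⁻¹ x := by
  split_ifs with h
  · simpa using revCycle_zpow_apply_of_sameCycle h (-1)
  · simpa using revCycle_zpow_apply_of_not_sameCycle h (-1)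

theorem revCycle_revCycle (σ : Perm I) (a : I) : revCycle (revCycle σ a) a = σ := by
  ext x
  rw [revCycle_apply]
  simp only [sameCycle_revCycle_iff]
  rw [revCycle_inv_apply, revCycle_apply]
  split_ifs <;> rfl

theorem sign_revCycle (σ : Perm I) (a : I) : sign (revCycle σ a) = sign σ := by
  rw [revCycle, Perm.sign_mul, Perm.sign_mul, Perm.sign_inv, ← sq, Int.units_sq, mul_one]

/-- From `i` the new permutation jumps to `σ j` and then follows the old cycle of `j`, which avoids
`i`, until it first returns to `j`. -/
theorem sameCycle_mul_swap {σ : Perm I} {i j : I} (h : ¬ σ.SameCycle i j) :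
    (σ * swap i j).SameCycle i j := by
  obtain ⟨p, hp, -, hpj⟩ := (SameCycle.refl σ j).exists_pow_eq
  classical
  let k := Nat.find (⟨p, hp, hpj⟩ : ∃ p, 0 < p ∧ (σ ^ p) j = j)
  have hk : 0 < k ∧ (σ ^ k) j = j := Nat.find_spec (⟨p, hp, hpj⟩ : ∃ p, 0 < p ∧ (σ ^ p) j = j)
  have hmin : ∀ m < k, 0 < m → (σ ^ m) j ≠ j := fun m hm h0 h1 =>
    Nat.find_min (⟨p, hp, hpj⟩ : ∃ p, 0 < p ∧ (σ ^ p) j = j) hm ⟨h0, h1⟩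
  have key : ∀ m, m + 1 ≤ k → ((σ * swap i j) ^ (m + 1)) i = (σ ^ (m + 1)) j := by
    intro m
    induction m with
    | zero => intro _; simp
    | succ m ih =>
      intro hm
      rw [pow_succ', mul_apply, ih (by omega), mul_apply, swap_apply_of_ne_of_ne, pow_succ' σ (m + 1),
        mul_apply]
      · exact fun h' => h (SameCycle.symm ⟨(m + 1 : ℕ), by rw [zpow_natCast]; exact h'⟩)
      · exact hmin _ (by omega) (by omega)
  refine ⟨k, ?_⟩
  obtain ⟨m, hm⟩ : ∃ m, k = m + 1 := ⟨k - 1, by omega⟩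
  rw [zpow_natCast, hm, key m hm.ge, ← hm, hk.2]

/-- The arc from `σ i` to the first visit of `j` is closed under the new permutation, since `j` is
sent back to `σ i`, and it omits `i`. -/
theorem not_sameCycle_mul_swap {σ : Perm I} {i j : I} (hij : i ≠ j) (h : σ.SameCycle i j) :
    ¬ (σ * swap i j).SameCycle i j := by
  obtain ⟨p, -, -, hpj⟩ := h.exists_pow_eq
  classical
  have hex : ∃ p, (σ ^ p) i = j := ⟨p, hpj⟩
  let k := Nat.find hex
  have hk : (σ ^ k) i = j := Nat.find_spec hex
  have hmin : ∀ m < k, (σ ^ m) i ≠ j := fun m hm => Nat.find_min hex hm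
  have hk0 : 0 < k := Nat.pos_of_ne_zero fun h0 => hij (by simpa [h0] using hk)
  -- A return to `i` after `m` steps would make `j` reachable in `k - m < k` steps.
  have hne : ∀ m, 0 < m → m ≤ k → (σ ^ m) i ≠ i := by
    intro m h0 hm hi
    apply hmin (k - m) (by omega)
    rw [← hk]
    conv_rhs => rw [show k = (k - m) + m by omega, pow_add, mul_apply, hi]
  let S : Set I := {x | ∃ m, 0 < m ∧ m ≤ k ∧ (σ ^ m) i = x}
  have hS : ∀ x ∈ S, (σ * swap i j) x ∈ S := by
    rintro x ⟨m, h0, hm, rfl⟩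
    rcases hm.lt_or_eq with hm' | rfl
    · refine ⟨m + 1, by omega, by omega, ?_⟩
      rw [mul_apply, swap_apply_of_ne_of_ne (hne m h0 hm) (hmin m hm'), pow_succ', mul_apply]
    · refine ⟨1, by omega, by omega, ?_⟩
      rw [mul_apply, hk, swap_apply_right, pow_one]
  intro hc
  obtain ⟨n, -, -, hn⟩ := hc.symm.exists_pow_eq
  have hjS : ∀ n : ℕ, ((σ * swap i j) ^ n) j ∈ S := by
    intro n
    induction n with
    | zero => exact ⟨k, hk0, le_rfl, hk⟩
    | succ n ih => rw [pow_succ', mul_apply]; exact hS _ ih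
  obtain ⟨m, h0, hm, h1⟩ := hjS n
  exact hne m h0 hm (h1.trans hn)

end RevCycle

/-! ### Spin sums over the cycles of a permutation -/

section LoopSum

open Equiv Equiv.Perm

variable {I J M : Type*} [Fintype I] [DecidableEq I] [Fintype J] [DecidableEq J] [Fintype M]

/-- The product of the traces of the matrix products of `A` along the cycles of `σ`, written as a
sum over all assignments of a matrix index to each point. -/
noncomputable def loopSum (A : I → I → Matrix M M ℂ) (σ : Perm I) : ℂ :=
  ∑ s : I → M, ∏ l, A l (σ l) (s l) (s (σ l))

/-- The weight `2 ^ (-c)`, where `c` is the number of cycles of `σ`. -/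
noncomputable def cycleWeight (σ : Perm I) : ℂ :=
  (loopSum (fun _ _ => (1 : Matrix (Fin 2) (Fin 2) ℂ)) σ)⁻¹

/-- The sum over all permutations of the signed products of half the traces along the cycles. -/
noncomputable def cycleExpansion (A : I → I → Matrix M M ℂ) : ℂ :=
  ∑ σ : Perm I, ((sign σ : ℤ) : ℂ) * cycleWeight σ * loopSum A σ

theorem loopSum_reindex (e : I ≃ J) (A : J → J → Matrix M M ℂ) (σ : Perm I) :
    loopSum (fun i j => A (e i) (e j)) σ = loopSum A (e.permCongr σ) := by
  unfold loopSum
  refine Fintype.sum_equiv (e.arrowCongr (Equiv.refl M)) _ _ fun s => ?_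
  refine Fintype.prod_equiv e _ _ fun l => ?_
  simp [Equiv.permCongr_apply]

theorem cycleWeight_permCongr (e : I ≃ J) (σ : Perm I) :
    cycleWeight (e.permCongr σ) = cycleWeight σ := by
  unfold cycleWeight
  rw [← loopSum_reindex e]

theorem cycleExpansion_reindex (e : I ≃ J) (A : J → J → Matrix M M ℂ) :
    cycleExpansion (fun i j => A (e i) (e j)) = cycleExpansion A := by
  unfold cycleExpansion
  refine Fintype.sum_equiv e.permCongr _ _ fun σ => ?_
  rw [cycleWeight_permCongr, sign_permCongr, loopSum_reindex]

/-- Only assignments constant along cycles survive; comparing such sets replaces counting cycles. -/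
theorem loopSum_one [DecidableEq M] (σ : Perm I) :
    loopSum (fun _ _ => (1 : Matrix M M ℂ)) σ =
      (Finset.univ.filter fun s : I → M => ∀ l, s (σ l) = s l).card := by
  unfold loopSum
  rw [Finset.card_filter]
  push_cast
  refine Finset.sum_congr rfl fun s _ => ?_
  simp only [Matrix.one_apply, Finset.prod_ite_zero, Finset.mem_univ, true_implies,
    Finset.prod_const_one, eq_comm]

theorem cycleExpansion_of_isEmpty [IsEmpty I] (A : I → I → Matrix M M ℂ) :
    cycleExpansion A = 1 := by
  simp [cycleExpansion, cycleWeight, loopSum]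

/-! #### Removing one point -/

/-- The new point is a fixed point and contributes the trace of the identity. -/
theorem loopSum_optionCongr [DecidableEq M] (A : Option I → Matrix M M ℂ) (hA : A none = 1)
    (σ : Perm I) :
    loopSum (fun l _ => A l) (optionCongr σ) =
      Fintype.card M * loopSum (fun l _ => A (some l)) σ := by
  unfold loopSum
  rw [← (Equiv.piOptionEquivProd (β := fun _ => M)).symm.sum_comp, Fintype.sum_prod_type]
  simp [Fintype.prod_option, hA, Equiv.piOptionEquivProd]

/-- Here `none` is inserted just before `i` in its cycle, where an identity factor changes nothing.
-/
theorem loopSum_swap_mul_optionCongr [DecidableEq M] (A : Option I → Matrix M M ℂ)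
    (hA : A none = 1) (i : I) (σ : Perm I) :
    loopSum (fun l _ => A l) (swap none (some i) * optionCongr σ) =
      loopSum (fun l _ => A (some l)) σ := by
  unfold loopSum
  rw [← (Equiv.piOptionEquivProd (β := fun _ => M)).symm.sum_comp, Fintype.sum_prod_type_right]
  refine Finset.sum_congr rfl fun s _ => ?_
  -- The identity matrix at `none` forces its index to equal that of `i`.
  rw [Finset.sum_eq_single (s i)]
  · rw [Fintype.prod_option]
    simp only [hA, Equiv.piOptionEquivProd, Equiv.coe_fn_symm_mk, Perm.mul_apply,
      optionCongr_apply, Option.map_none, swap_apply_left, Matrix.one_apply_eq, one_mul,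
      Option.map_some]
    refine Finset.prod_congr rfl fun l _ => ?_
    by_cases h : σ l = i
    · simp [h]
    · rw [swap_apply_of_ne_of_ne (by simp) (by simpa using h)]
  · intro a _ ha
    rw [Fintype.prod_option]
    simp [hA, Equiv.piOptionEquivProd, ha]
  · simp

/-- Each permutation of `I` extends by fixing `none`, with an extra half-trace `card M / 2`, or by
inserting it before one of the `card I` points, which flips the sign and keeps the weight. -/
theorem cycleExpansion_option [DecidableEq M] (A : Option I → Matrix M M ℂ) (hA : A none = 1) :
    cycleExpansion (fun l _ => A l) =
      ((Fintype.card M : ℂ) / 2 - Fintype.card I) * cycleExpansion fun l _ => A (some l) := by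
  have h1 : ∀ σ : Perm I, cycleWeight (optionCongr σ) = cycleWeight σ / 2 := by
    intro σ
    unfold cycleWeight
    rw [loopSum_optionCongr (fun _ => 1) rfl]
    simp [div_eq_mul_inv]
  have h2 : ∀ (i : I) (σ : Perm I),
      cycleWeight (swap none (some i) * optionCongr σ) = cycleWeight σ := by
    intro i σ
    unfold cycleWeight
    rw [loopSum_swap_mul_optionCongr (fun _ => 1) rfl]
  unfold cycleExpansion
  rw [← decomposeOption.symm.sum_comp, Fintype.sum_prod_type_right, Finset.mul_sum]
  refine Finset.sum_congr rfl fun σ _ => ?_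
  rw [Fintype.sum_option]
  simp only [decomposeOption_symm_apply, swap_self, ← Perm.one_def, one_mul, optionCongr_sign, h1,
    loopSum_optionCongr A hA, Perm.sign_mul, h2, loopSum_swap_mul_optionCongr A hA]
  simp
  ring

/-! #### Self-dual families -/

/-- Off `C` the index `f l` is kept, on `C` it is replaced by the other index of `g l`. -/
def flipOn (C : I → Prop) [DecidablePred C] (f g : I → Fin 2) (l : I) : Fin 2 :=
  if C l then (g l).rev else f l

/-- The sign attached to an index of a `2 × 2` matrix when passing to the adjugate. -/
def spinSign (a : Fin 2) : ℂ := if a = 0 then 1 else -1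

theorem spinSign_mul_self (a : Fin 2) : spinSign a * spinSign a = 1 := by
  unfold spinSign; split_ifs <;> norm_num

theorem adjugate_apply_eq_spinSign (B : Matrix (Fin 2) (Fin 2) ℂ) (a b : Fin 2) :
    B.adjugate a b = spinSign a * spinSign b * B b.rev a.rev := by
  rw [Matrix.adjugate_fin_two]
  fin_cases a <;> fin_cases b <;> simp [spinSign]

variable {A : I → I → Matrix (Fin 2) (Fin 2) ℂ}

/-- Adjugate entries are signed entries with both indices flipped and exchanged. Row indices `f` and
column indices `g` are kept apart because `loopSum_eq_add` permutes only the rows. -/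
theorem prod_revCycle (hA : ∀ i j, A j i = (A i j).adjugate) (σ : Perm I) (a : I)
    (f g : I → Fin 2) :
    ∏ l, A l (revCycle σ a l) (f l) (g (revCycle σ a l)) =
      (∏ l, if σ.SameCycle a l then spinSign (f l) * spinSign (g l) else 1) *
        ∏ l, A l (σ l) (flipOn (σ.SameCycle a) f g l) (flipOn (σ.SameCycle a) g f (σ l)) := by
  have hC : ∀ l, σ.SameCycle a (σ l) ↔ σ.SameCycle a l := fun l => sameCycle_apply_right
  have e1 : ∀ l, A l (revCycle σ a l) (f l) (g (revCycle σ a l)) =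
      (if σ.SameCycle a l then A l (σ⁻¹ l) (f l) (g (σ⁻¹ l)) else 1) *
        (if σ.SameCycle a l then 1 else A l (σ l) (f l) (g (σ l))) := by
    intro l
    rw [revCycle_apply]
    split_ifs <;> simp
  have e2 : ∀ l, (if σ.SameCycle a l then spinSign (f l) * spinSign (g l) else 1) =
      (if σ.SameCycle a l then spinSign (f l) else 1) *
        (if σ.SameCycle a l then spinSign (g l) else 1) := by
    intro l
    split_ifs <;> simp
  simp only [e1, e2, Finset.prod_mul_distrib]
  rw [← Equiv.prod_comp σ (fun l => if σ.SameCycle a l then A l (σ⁻¹ l) (f l) (g (σ⁻¹ l)) else 1),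
    ← Equiv.prod_comp σ (fun l => if σ.SameCycle a l then spinSign (f l) else 1)]
  simp only [← Finset.prod_mul_distrib]
  refine Finset.prod_congr rfl fun l _ => ?_
  have hi : σ⁻¹ (σ l) = l := σ.symm_apply_apply l
  simp only [hC, flipOn, hi]
  split_ifs with h
  · rw [hA l (σ l), adjugate_apply_eq_spinSign]
    ring
  · simp

theorem flipOn_flipOn {I : Type*} (C : I → Prop) [DecidablePred C] (s : I → Fin 2) :
    flipOn C (flipOn C s s) (flipOn C s s) = s := by
  funext l
  unfold flipOn
  split_ifs <;> simp

/-- `flipOn` as an involution. -/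
def flipOnEquiv (C : I → Prop) [DecidablePred C] : (I → Fin 2) ≃ (I → Fin 2) where
  toFun s := flipOn C s s
  invFun s := flipOn C s s
  left_inv := flipOn_flipOn C
  right_inv := flipOn_flipOn C

theorem loopSum_revCycle (hA : ∀ i j, A j i = (A i j).adjugate) (σ : Perm I) (a : I) :
    loopSum A (revCycle σ a) = loopSum A σ := by
  unfold loopSum
  simp only [prod_revCycle hA]
  refine Fintype.sum_equiv (flipOnEquiv (σ.SameCycle a)) _ _ fun s => ?_
  simp [spinSign_mul_self, flipOnEquiv]

theorem cycleWeight_revCycle (σ : Perm I) (a : I) :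
    cycleWeight (revCycle σ a) = cycleWeight σ := by
  unfold cycleWeight
  rw [loopSum_revCycle fun _ _ => by simp]

/-- Equal rows let the points be relabelled by the swap, which then acts only on the row indices. -/
theorem loopSum_mul_swap {i j : I} (hr : ∀ l, A i l = A j l) (σ : Perm I) :
    loopSum A (σ * swap i j) =
      ∑ s : I → Fin 2, ∏ l, A l (σ l) (s (swap i j l)) (s (σ l)) := by
  have h : ∀ l, A (swap i j l) = A l := by
    intro l
    rcases eq_or_ne l i with rfl | h1
    · rw [swap_apply_left]; exact funext fun l => (hr l).symm
    rcases eq_or_ne l j with rfl | h2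
    · rw [swap_apply_right]; exact funext fun l => hr l
    · rw [swap_apply_of_ne_of_ne h1 h2]
  unfold loopSum
  refine Finset.sum_congr rfl fun s _ => ?_
  rw [← Equiv.prod_comp (swap i j)]
  simp [h]

theorem sum_update (i : I) (F : (I → Fin 2) → ℂ) :
    ∑ s, F s = 2⁻¹ * ∑ s, ∑ a, F (Function.update s i a) := by
  have e : ∀ s a, Function.update s i a =
      (funSplitAt i (Fin 2)).symm (a, (funSplitAt i (Fin 2) s).2) := by
    intro s a
    funext l
    by_cases h : l = i
    · subst h; simp
    · simp [h]
  simp only [e]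
  rw [Equiv.sum_comp (funSplitAt i (Fin 2))
    (fun p => ∑ a, F ((funSplitAt i (Fin 2)).symm (a, p.2))),
    ← Equiv.sum_comp (funSplitAt i (Fin 2)).symm F, Fintype.sum_prod_type, Fintype.sum_prod_type]
  simp only [Finset.sum_const, Finset.card_univ, Fintype.card_fin, nsmul_eq_mul]
  rw [Finset.sum_comm]
  push_cast
  ring

/-- Averaging over the indices at `i` and `j` reduces an identity of spin sums to a finite check at
these two points. -/
theorem sum_update₂ (i j : I) (F : (I → Fin 2) → ℂ) :
    ∑ s, F s =
      4⁻¹ * ∑ s, ∑ b, ∑ a, F (Function.update (Function.update s i a) j b) := by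
  rw [sum_update j, Finset.sum_comm, Finset.sum_congr rfl fun b _ =>
    sum_update i fun s => F (Function.update s j b)]
  rw [← Finset.mul_sum, Finset.sum_comm]
  ring

/-- Splitting a product of two traces: `tr P * tr Q = tr (P Q) + tr (P Q^*)`. -/
theorem loopSum_eq_add (hA : ∀ i j, A j i = (A i j).adjugate) {i j : I}
    (hr : ∀ l, A i l = A j l) {σ : Perm I} (hσ : ¬ σ.SameCycle i j) :
    loopSum A σ = loopSum A (σ * swap i j) + loopSum A (revCycle σ j * swap i j) := by
  have hij : i ≠ j := fun h => hσ (h ▸ SameCycle.refl σ i)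
  have hji : ¬ σ.SameCycle j i := fun h => hσ h.symm
  have hjj : σ.SameCycle j j := SameCycle.refl σ j
  -- All three loop sums are contractions of `W` at `i` and `j`: parallel, crossed, and with two
  -- antisymmetric tensors. The claim is `δδ - δδ = εε` in dimension two.
  set W : (I → Fin 2) → (I → Fin 2) → ℂ := fun f g => ∏ l, A l (σ l) (f l) (g (σ l)) with hW
  have h1 : loopSum A σ = ∑ s, W s s := rfl
  have h2 : loopSum A (σ * swap i j) =
      ∑ s, W (Function.update (Function.update s i (s j)) j (s i)) s := by
    rw [loopSum_mul_swap hr]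
    refine Finset.sum_congr rfl fun s _ => Finset.prod_congr rfl fun l _ => ?_
    congr 1
    rcases eq_or_ne l j with rfl | h
    · simp
    rcases eq_or_ne l i with rfl | h'
    · simp [h]
    · simp [h, h', swap_apply_of_ne_of_ne h' h]
  have h3 : loopSum A (revCycle σ j * swap i j) =
      ∑ s, spinSign (s i) * spinSign (s j).rev *
        W (Function.update s i (s j).rev) (Function.update s j (s i).rev) := by
    rw [loopSum_mul_swap hr]
    refine Fintype.sum_equiv (flipOnEquiv (σ.SameCycle j)) _ _ fun s => ?_
    rw [prod_revCycle hA σ j (fun l => s (swap i j l)) s]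
    congr 1
    · rw [Finset.prod_eq_single j]
      · simp [flipOnEquiv, flipOn, hji, hjj]
      · intro l _ hl
        split_ifs with h
        · have hli : l ≠ i := fun h' => hji (h' ▸ h)
          rw [swap_apply_of_ne_of_ne hli hl, spinSign_mul_self]
        · rfl
      · simp
    · refine Finset.prod_congr rfl fun l _ => ?_
      congr 1
      · rcases eq_or_ne l i with rfl | h
        · simp [flipOnEquiv, flipOn, hji, hjj]
        · rw [Function.update_of_ne h]
          rcases eq_or_ne l j with h' | h'
          · simp [flipOnEquiv, flipOn, hjj, h']
          · simp [flipOnEquiv, flipOn, swap_apply_of_ne_of_ne h h']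
      · generalize σ l = l
        rcases eq_or_ne l j with h | h
        · subst h; simp [flipOnEquiv, flipOn, hji, hjj]
        · rw [Function.update_of_ne h]
          rcases eq_or_ne l i with rfl | h'
          · simp [flipOnEquiv, flipOn, hji]
          · simp [flipOnEquiv, flipOn, swap_apply_of_ne_of_ne h' h]
  rw [h1, h2, h3, ← Finset.sum_add_distrib, sum_update₂ i j, sum_update₂ i j (fun s => _ + _)]
  congr 1
  refine Finset.sum_congr rfl fun s _ => ?_
  have u1 : ∀ a b c : Fin 2, Function.update (Function.update (Function.update s i a) j b) i c =
      Function.update (Function.update s i c) j b := by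
    intro a b c
    rw [Function.update_comm hij.symm, Function.update_idem]
  simp only [u1, Function.update_idem, Function.update_self, Function.update_of_ne hij,
    Fin.sum_univ_two, spinSign]
  simp
  ring

/-- Merging two cycles removes one factor `1 / 2`. This is read off from `loopSum_eq_add` for
identity matrices, whose two summands count the same assignments. -/
theorem cycleWeight_mul_swap {i j : I} {σ : Perm I} (hσ : ¬ σ.SameCycle i j) :
    cycleWeight (σ * swap i j) = 2 * cycleWeight σ := by
  have key : ∀ τ : Perm I, ¬ τ.SameCycle i j → ∀ s : I → Fin 2,
      (∀ l, s ((τ * swap i j) l) = s l) ↔ (∀ l, s (τ l) = s l) ∧ s i = s j := by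
    intro τ hτ s
    have hsw : s i = s j → ∀ l, s (swap i j l) = s l := by
      intro h l
      rcases eq_or_ne l i with rfl | h1
      · simp [h]
      rcases eq_or_ne l j with rfl | h2
      · simp [h]
      · rw [swap_apply_of_ne_of_ne h1 h2]
    constructor
    · intro h
      have hs : s i = s j := by
        obtain ⟨n, -, -, hn⟩ := (sameCycle_mul_swap hτ).exists_pow_eq
        rw [← hn]
        clear hn
        induction n with
        | zero => rfl
        | succ n ih => rw [pow_succ', mul_apply, h, ← ih]
      refine ⟨fun l => ?_, hs⟩
      have := h (swap i j l)
      rw [mul_apply, swap_apply_self] at this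
      rw [this, hsw hs]
    · rintro ⟨h, hs⟩ l
      rw [mul_apply, h, hsw hs]
  have hrev : ∀ s : I → Fin 2, (∀ l, s (revCycle σ j l) = s l) ↔ ∀ l, s (σ l) = s l := by
    have : ∀ τ : Perm I, ∀ s : I → Fin 2, (∀ l, s (τ l) = s l) → ∀ l, s (revCycle τ j l) = s l := by
      intro τ s h l
      rw [revCycle_apply]
      split_ifs
      · rw [← h (τ⁻¹ l)]; exact congrArg s (τ.apply_symm_apply l)
      · exact h l
    exact fun s => ⟨fun h => by simpa [revCycle_revCycle] using this _ s h, this σ s⟩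
  have hσ' : ¬ (revCycle σ j).SameCycle i j := by rwa [sameCycle_revCycle_iff]
  have h := loopSum_eq_add (A := fun _ _ => (1 : Matrix (Fin 2) (Fin 2) ℂ)) (by simp) (i := i)
    (j := j) (by simp) hσ
  have h' : loopSum (fun _ _ => (1 : Matrix (Fin 2) (Fin 2) ℂ)) (revCycle σ j * swap i j) =
      loopSum (fun _ _ => (1 : Matrix (Fin 2) (Fin 2) ℂ)) (σ * swap i j) := by
    rw [loopSum_one, loopSum_one]
    simp only [key _ hσ, key _ hσ', hrev]
  unfold cycleWeight
  rw [h, h', ← two_mul, mul_inv, ← mul_assoc]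
  norm_num

/-- The expansion of a self-dual family with two equal rows vanishes. -/
theorem cycleExpansion_eq_zero (hA : ∀ i j, A j i = (A i j).adjugate) {i j : I} (hij : i ≠ j)
    (hr : ∀ l, A i l = A j l) : cycleExpansion A = 0 := by
  set F : Perm I → ℂ := fun σ => ((sign σ : ℤ) : ℂ) * cycleWeight σ * loopSum A σ with hF
  set S : Finset (Perm I) := Finset.univ.filter fun σ => ¬ σ.SameCycle i j with hS
  -- Multiplication by the swap exchanges permutations separating `i` and `j` with those joining
  -- them.
  have h1 : cycleExpansion A = ∑ σ ∈ S, F σ + ∑ σ ∈ S, F (σ * swap i j) := by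
    unfold cycleExpansion
    rw [← Finset.sum_filter_add_sum_filter_not Finset.univ (fun σ : Perm I => ¬ σ.SameCycle i j)]
    congr 1
    refine Finset.sum_nbij' (fun σ => σ * swap i j) (fun σ => σ * swap i j) ?_ ?_ ?_ ?_ ?_
    · simpa [hS] using fun σ h => not_sameCycle_mul_swap hij h
    · simpa [hS] using fun σ h => sameCycle_mul_swap h
    · simp [mul_assoc]
    · simp [mul_assoc]
    · simp [hF, mul_assoc]
  have h2 : ∑ σ ∈ S, F (σ * swap i j) = ∑ σ ∈ S, F (revCycle σ j * swap i j) := by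
    refine Finset.sum_nbij' (fun σ => revCycle σ j) (fun σ => revCycle σ j) ?_ ?_ ?_ ?_ ?_
    · simp [hS, sameCycle_revCycle_iff]
    · simp [hS, sameCycle_revCycle_iff]
    · simp [revCycle_revCycle]
    · simp [revCycle_revCycle]
    · simp [revCycle_revCycle]
  -- Merged terms have opposite sign and double weight, so trace splitting cancels each summand. By
  -- `h2` the last two terms have equal sums, and the total is twice the expansion.
  have h3 : ∑ σ ∈ S, (2 * F σ + F (σ * swap i j) + F (revCycle σ j * swap i j)) = 0 := by
    refine Finset.sum_eq_zero fun σ hσ => ?_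
    have hσ : ¬ σ.SameCycle i j := by simpa [hS] using hσ
    have hσ' : ¬ (revCycle σ j).SameCycle i j := by rwa [sameCycle_revCycle_iff]
    simp only [hF, cycleWeight_mul_swap hσ, cycleWeight_mul_swap hσ', cycleWeight_revCycle,
      Perm.sign_mul, sign_swap hij, sign_revCycle, loopSum_eq_add hA hr hσ]
    push_cast
    ring
  rw [Finset.sum_add_distrib, Finset.sum_add_distrib, ← Finset.mul_sum, ← h2] at h3
  rw [h1]
  linear_combination h3 / 2

end LoopSum

/-! ### The Moore–Dyson determinant of a self-dual matrix -/

section TraceExpansion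

variable {M : Type*} [Fintype M] [DecidableEq M]

/-- The test function `F` is arbitrary so that the induction can absorb the last matrix into it. -/
theorem sum_prod_range_mul (p : ℕ) (B : ℕ → Matrix M M ℂ) (F : M → M → ℂ) :
    ∑ a, ∑ c, ((List.range p).map B).prod a c * F a c =
      ∑ s : Fin (p + 1) → M,
        (∏ t : Fin p, B t (s t.castSucc) (s t.succ)) * F (s 0) (s (Fin.last p)) := by
  induction p generalizing F with
  | zero =>
    rw [← (Equiv.funUnique (Fin 1) M).symm.sum_comp]
    simp [Matrix.one_apply]
  | succ p ih =>
    have h : ∀ a, ∑ c, ((List.range (p + 1)).map B).prod a c * F a c =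
        ∑ b, ((List.range p).map B).prod a b * ∑ c, B p b c * F a c := by
      intro a
      simp only [List.range_succ, List.map_append, List.prod_append, List.map_cons, List.map_nil,
        List.prod_singleton, Matrix.mul_apply, Finset.sum_mul, Finset.mul_sum, mul_assoc]
      exact Finset.sum_comm
    simp only [h]
    rw [ih fun a b => ∑ c, B p b c * F a c]
    refine Eq.trans ?_ ((Fin.snocEquiv fun _ => M).sum_comp _)
    rw [Fintype.sum_prod_type_right]
    refine Finset.sum_congr rfl fun s _ => ?_
    rw [Finset.mul_sum]
    refine Finset.sum_congr rfl fun c _ => ?_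
    rw [Fin.prod_univ_castSucc]
    have h0 : (Fin.snoc (α := fun _ => M) s c : Fin (p + 1 + 1) → M) 0 = s 0 := by
      rw [← Fin.castSucc_zero, Fin.snoc_castSucc]
    simp only [Fin.snocEquiv, Equiv.coe_fn_mk, Fin.snoc_castSucc, Fin.snoc_last, Fin.succ_last,
      ← Fin.castSucc_succ, h0, Fin.val_castSucc, Fin.val_last]
    ring

theorem val_finRotate (p : ℕ) (t : Fin p) : (finRotate p t : ℕ) = (t + 1) % p := by
  cases p with
  | zero => exact t.elim0
  | succ q => rw [finRotate_apply, Fin.val_add, Fin.val_one', Nat.add_mod_mod]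

theorem trace_prod_range {p : ℕ} (hp : p ≠ 0) (B : ℕ → Matrix M M ℂ) :
    (((List.range p).map B).prod).trace =
      ∑ s : Fin p → M, ∏ t : Fin p, B t (s t) (s (finRotate p t)) := by
  obtain ⟨q, rfl⟩ := Nat.exists_eq_succ_of_ne_zero hp
  have h := sum_prod_range_mul q B fun a c => B q c a
  simp only [Nat.succ_eq_add_one, Matrix.trace, Matrix.diag_apply, List.range_succ,
    List.map_append, List.prod_append, List.map_cons, List.map_nil, List.prod_singleton,
    Matrix.mul_apply]
  rw [h]
  refine Finset.sum_congr rfl fun s _ => ?_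
  rw [Fin.prod_univ_castSucc]
  simp [finRotate_apply]

end TraceExpansion

/-! ### Coordinates adapted to the cycles -/

section Leaders

open Equiv Equiv.Perm

variable {n : ℕ}

theorem mem_mooreLeaders {σ : Perm (Fin n)} {a : Fin n} :
    a ∈ mooreLeaders σ ↔ ∀ b, σ.SameCycle a b → b ≤ a := by
  simp [mooreLeaders]

theorem nodup_mooreLeaders (σ : Perm (Fin n)) : (mooreLeaders σ).Nodup :=
  (List.nodup_reverse.2 (List.nodup_finRange n)).filter _

theorem minimalPeriod_ne_zero (σ : Perm (Fin n)) (a : Fin n) :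
    Function.minimalPeriod σ a ≠ 0 :=
  (Function.minimalPeriod_pos_of_mem_periodicPts (σ.injective.mem_periodicPts a)).ne'

theorem pow_mod_minimalPeriod (σ : Perm (Fin n)) (a : Fin n) (t : ℕ) :
    (σ ^ (t % Function.minimalPeriod σ a)) a = (σ ^ t) a := by
  rw [← iterate_eq_pow, ← iterate_eq_pow, Function.iterate_mod_minimalPeriod_eq]

/-- A point is determined by the largest element of its cycle and the number of steps from it; in
these coordinates `σ` rotates each fibre. -/
theorem leaderPoint_bijective (σ : Perm (Fin n)) :
    Function.Bijective
      (fun x : Σ a : {a // a ∈ mooreLeaders σ}, Fin (Function.minimalPeriod σ a.1) =>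
        (σ ^ (x.2 : ℕ)) x.1.1) := by
  constructor
  · rintro ⟨⟨a, ha⟩, s⟩ ⟨⟨b, hb⟩, t⟩ h
    have h : (σ ^ (s : ℕ)) a = (σ ^ (t : ℕ)) b := h
    have hab : σ.SameCycle a b := by
      rw [← sameCycle_pow_left (n := s), h, sameCycle_pow_left]
    obtain rfl : a = b :=
      le_antisymm (mem_mooreLeaders.1 hb a hab.symm) (mem_mooreLeaders.1 ha b hab)
    rw [← iterate_eq_pow, ← iterate_eq_pow] at h
    have : s = t := Fin.ext (Function.iterate_injOn_Iio_minimalPeriod s.2 t.2 h)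
    rw [this]
  · intro b
    obtain ⟨a, ha, hmax⟩ := (Finset.univ.filter fun a => σ.SameCycle b a).exists_max_image id
      ⟨b, by simp [SameCycle.refl]⟩
    have hab : σ.SameCycle b a := by simpa using ha
    have hl : a ∈ mooreLeaders σ :=
      mem_mooreLeaders.2 fun c hc => hmax c (by simpa using hab.trans hc)
    obtain ⟨t, -, -, ht⟩ := hab.symm.exists_pow_eq
    exact ⟨⟨⟨a, hl⟩, ⟨t % Function.minimalPeriod σ a,
      Nat.mod_lt _ (Nat.pos_of_ne_zero (minimalPeriod_ne_zero σ a))⟩⟩,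
      (pow_mod_minimalPeriod σ a t).trans ht⟩

theorem loopSum_eq_prod_trace {M : Type*} [Fintype M] [DecidableEq M]
    (A : Fin n → Fin n → Matrix M M ℂ) (σ : Perm (Fin n)) :
    loopSum A σ = ((mooreLeaders σ).map fun a => Matrix.trace
      (((List.range (Function.minimalPeriod σ a)).map
        fun t => A ((σ ^ t) a) ((σ ^ (t + 1)) a)).prod)).prod := by
  set e := Equiv.ofBijective _ (leaderPoint_bijective σ) with he
  have hσ : ∀ x, σ (e x) = e ⟨x.1, finRotate _ x.2⟩ := by
    rintro ⟨a, t⟩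
    simp only [he, Equiv.ofBijective_apply]
    rw [val_finRotate, pow_mod_minimalPeriod, pow_succ', Perm.mul_apply]
  rw [← List.prod_toFinset _ (nodup_mooreLeaders σ), ← Finset.prod_coe_sort]
  unfold loopSum
  rw [← (e.arrowCongr (Equiv.refl M)).sum_comp]
  have h1 : ∀ s : (Σ a : {a // a ∈ mooreLeaders σ}, Fin (Function.minimalPeriod σ a.1)) → M,
      ∏ l, A l (σ l) (e.arrowCongr (Equiv.refl M) s l) (e.arrowCongr (Equiv.refl M) s (σ l)) =
      ∏ a : {a // a ∈ mooreLeaders σ}, ∏ t : Fin (Function.minimalPeriod σ a.1),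
        A ((σ ^ (t : ℕ)) a.1) ((σ ^ ((t : ℕ) + 1)) a.1) (Equiv.piCurry (fun _ _ => M) s a t)
          (Equiv.piCurry (fun _ _ => M) s a (finRotate _ t)) := by
    intro s
    rw [← e.prod_comp, Fintype.prod_sigma]
    refine Finset.prod_congr rfl fun a _ => Finset.prod_congr rfl fun t _ => ?_
    rw [hσ]
    simp only [Equiv.arrowCongr_apply, Function.comp_apply, Equiv.symm_apply_apply,
      Equiv.refl_apply, Equiv.piCurry_apply, Sigma.curry]
    congr 1
    rw [pow_succ', Perm.mul_apply]
    exact (hσ ⟨a, t⟩).symm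
  simp only [h1]
  rw [(Equiv.piCurry (fun (a : {a // a ∈ mooreLeaders σ})
    (_ : Fin (Function.minimalPeriod σ a.1)) => M)).sum_comp (fun s =>
      ∏ a : {a // a ∈ mooreLeaders σ}, ∏ t : Fin (Function.minimalPeriod σ a.1),
        A ((σ ^ (t : ℕ)) a.1) ((σ ^ ((t : ℕ) + 1)) a.1) (s a t) (s a (finRotate _ t)))]
  rw [← Fintype.piFinset_univ]
  refine (Finset.prod_univ_sum (fun _ => Finset.univ)
    fun (a : {a // a ∈ mooreLeaders σ}) (s : Fin (Function.minimalPeriod σ a.1) → M) =>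
      ∏ t : Fin (Function.minimalPeriod σ a.1),
        A ((σ ^ (t : ℕ)) a.1) ((σ ^ ((t : ℕ) + 1)) a.1) (s t) (s (finRotate _ t))).symm.trans ?_
  refine Fintype.prod_equiv (Equiv.subtypeEquivRight fun a => by simp) _ _ fun a => ?_
  exact (trace_prod_range (minimalPeriod_ne_zero σ a.1)
    fun t => A ((σ ^ t) a.1) ((σ ^ (t + 1)) a.1)).symm

theorem cycleWeight_eq_prod_leaders (σ : Perm (Fin n)) :
    cycleWeight σ = ((mooreLeaders σ).map fun _ => (2⁻¹ : ℂ)).prod := by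
  unfold cycleWeight
  rw [loopSum_eq_prod_trace]
  simp

end Leaders

/-! ### From quaternion cycle products to half-traces -/

section MooreDetExpansion

open Equiv Equiv.Perm

/-- The representation of complexified quaternions by complex `2 × 2` matrices. -/
noncomputable def quatMatrix : CQuat →+* Matrix (Fin 2) (Fin 2) ℂ where
  toFun q := !![q.re + q.imI * Complex.I, q.imJ + q.imK * Complex.I;
    -q.imJ + q.imK * Complex.I, q.re - q.imI * Complex.I]
  map_one' := by
    change !![(1 : ℂ) + 0 * Complex.I, 0 + 0 * Complex.I; -0 + 0 * Complex.I, 1 - 0 * Complex.I] = 1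
    ext i j; fin_cases i <;> fin_cases j <;> simp
  map_zero' := by
    change !![(0 : ℂ) + 0 * Complex.I, 0 + 0 * Complex.I; -0 + 0 * Complex.I, 0 - 0 * Complex.I] = 0
    ext i j; fin_cases i <;> fin_cases j <;> simp
  map_add' p q := by ext i j; fin_cases i <;> fin_cases j <;> simp <;> ring
  map_mul' p q := by
    have h : Complex.I ^ 2 = -1 := Complex.I_sq
    ext i j
    fin_cases i <;> fin_cases j <;> simp [Matrix.mul_apply, Fin.sum_univ_two] <;> ring_nf <;>
      rw [h] <;> ring

theorem quatMatrix_apply (q : CQuat) : quatMatrix q =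
    !![q.re + q.imI * Complex.I, q.imJ + q.imK * Complex.I;
      -q.imJ + q.imK * Complex.I, q.re - q.imI * Complex.I] := rfl

theorem quatMatrix_star (q : CQuat) : quatMatrix (star q) = (quatMatrix q).adjugate := by
  rw [Matrix.adjugate_fin_two, quatMatrix_apply, quatMatrix_apply]
  ext i j
  fin_cases i <;> fin_cases j <;> simp <;> ring

theorem trace_quatMatrix (q : CQuat) : (quatMatrix q).trace = 2 * q.re := by
  rw [quatMatrix_apply, Matrix.trace_fin_two]
  simp
  ring

variable {n : ℕ}

theorem minimalPeriod_eq_of_zpow {σ τ : Perm (Fin n)} {b : Fin n}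
    (h : ∀ m : ℕ, (τ ^ m) b = b ↔ (σ ^ m) b = b) :
    Function.minimalPeriod τ b = Function.minimalPeriod σ b := by
  rw [Function.minimalPeriod_eq_minimalPeriod_iff]
  intro m
  rw [Function.IsPeriodicPt, Function.IsFixedPt, Function.IsPeriodicPt, Function.IsFixedPt,
    iterate_eq_pow, iterate_eq_pow, h]

theorem mooreLeaders_revCycle (σ : Perm (Fin n)) (a : Fin n) :
    mooreLeaders (revCycle σ a) = mooreLeaders σ := by
  simp only [mooreLeaders, sameCycle_revCycle_iff]

theorem mooreCycleProd_revCycle_of_not_sameCycle (X : Matrix (Fin n) (Fin n) CQuat)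
    {σ : Perm (Fin n)} {a b : Fin n} (h : ¬ σ.SameCycle a b) :
    mooreCycleProd X (revCycle σ a) b = mooreCycleProd X σ b := by
  have hp : ∀ m : ℕ, (revCycle σ a ^ m) b = (σ ^ m) b := fun m => by
    simpa using revCycle_zpow_apply_of_not_sameCycle h m
  unfold mooreCycleProd
  rw [minimalPeriod_eq_of_zpow (σ := σ) fun m => by rw [hp]]
  simp only [hp]

theorem star_prod_map_range (f : ℕ → CQuat) (p : ℕ) :
    star ((List.range p).map f).prod =
      ((List.range p).map fun t => star (f (p - 1 - t))).prod := by
  induction p generalizing f with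
  | zero => simp
  | succ p ih =>
    rw [List.range_succ_eq_map (n := p), List.map_cons, List.prod_cons, List.map_map,
      ← List.range_succ_eq_map, List.range_succ, List.map_append, List.prod_append, star_mul, ih]
    refine congrArg₂ _ (congrArg List.prod (List.map_congr_left fun t ht => ?_)) (by simp)
    have ht : t < p := List.mem_range.1 ht
    rw [Function.comp_apply, Nat.succ_eq_add_one, show p - 1 - t + 1 = p + 1 - 1 - t by omega]

/-- The reversed cycle meets the conjugated factors in the opposite order, exactly as conjugation of
a product does. -/
theorem mooreCycleProd_revCycle {X : Matrix (Fin n) (Fin n) CQuat}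
    (hX : ∀ i j, X j i = star (X i j)) (σ : Perm (Fin n)) (a : Fin n) :
    mooreCycleProd X (revCycle σ a) a = star (mooreCycleProd X σ a) := by
  have hp : ∀ m : ℕ, (revCycle σ a ^ m) a = (σ ^ (-m : ℤ)) a := fun m => by
    simpa using revCycle_zpow_apply_of_sameCycle (SameCycle.refl σ a) m
  unfold mooreCycleProd
  rw [minimalPeriod_eq_of_zpow (σ := σ) fun m => by
    rw [hp, zpow_neg, inv_eq_iff_eq, zpow_natCast, eq_comm], star_prod_map_range]
  refine congrArg List.prod (List.map_congr_left fun t ht => ?_)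
  have ht : t < Function.minimalPeriod σ a := List.mem_range.1 ht
  have hs : ∀ t ≤ Function.minimalPeriod σ a,
      (revCycle σ a ^ t) a = (σ ^ (Function.minimalPeriod σ a - t)) a := by
    intro t ht
    have h0 : (σ ^ Function.minimalPeriod σ a) a = a := by
      rw [← iterate_eq_pow]; exact Function.iterate_minimalPeriod
    rw [hp, zpow_neg, inv_eq_iff_eq, zpow_natCast, ← Perm.mul_apply, ← pow_add,
      Nat.add_sub_cancel' ht, h0]
  rw [hs t ht.le, hs (t + 1) ht, ← hX]
  congr 3 <;> omega

/-- An ordered product is additive in each single entry; only the scalar `c` must be central. -/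
theorem prod_map_average {α R : Type*} [Ring R] {l : List α} (hl : l.Nodup) {a : α} (ha : a ∈ l)
    {f g h : α → R} {c : R} (hc : ∀ x, c * x = x * c) (hfa : f a = c * (g a + h a))
    (hg : ∀ b ≠ a, g b = f b) (hh : ∀ b ∈ l, b ≠ a → h b = f b) :
    (l.map f).prod = c * ((l.map g).prod + (l.map h).prod) := by
  induction l with
  | nil => simp at ha
  | cons b l ih =>
    simp only [List.map_cons, List.prod_cons]
    obtain ⟨hb, hl⟩ := List.nodup_cons.1 hl
    by_cases hba : b = a
    · subst hba
      have hne : ∀ c ∈ l, c ≠ b := fun c hc h => hb (h ▸ hc)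
      rw [List.map_congr_left (f := g) (g := f) fun c hc => hg c (hne c hc),
        List.map_congr_left (f := h) (g := f) fun c hc => hh c (by simp [hc]) (hne c hc), hfa,
        mul_assoc, add_mul]
    · have hal : a ∈ l := by
        rcases List.mem_cons.1 ha with h | h
        · exact absurd h.symm hba
        · exact h
      rw [ih hl hal fun c hc => hh c (by simp [hc]), hg b hba, hh b (by simp) hba,
        ← mul_assoc, ← hc, mul_assoc, mul_add]

theorem coe_re_eq_average (q : CQuat) :
    ((q.re : ℂ) : CQuat) = ((2⁻¹ : ℂ) : CQuat) * (q + star q) := by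
  ext <;> simp
  ring

theorem coe_half_mul_add_self (q : CQuat) : ((2⁻¹ : ℂ) : CQuat) * (q + q) = q := by
  ext <;> simp <;> ring

/-- In the Moore–Dyson determinant of a self-dual matrix, the cycle products may be replaced by
their scalar parts. -/
theorem mooreDet_eq_sum_re {X : Matrix (Fin n) (Fin n) CQuat}
    (hX : ∀ i j, X j i = star (X i j)) (S : Finset (Fin n)) :
    mooreDet X = ∑ σ : Perm (Fin n), (sign σ : ℤ) • ((mooreLeaders σ).map fun a =>
      if a ∈ S then (((mooreCycleProd X σ a).re : ℂ) : CQuat) else mooreCycleProd X σ a).prod := by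
  induction S using Finset.induction_on with
  | empty => simp [mooreDet]
  | insert a S haS ih =>
    set P : Finset (Fin n) → Perm (Fin n) → CQuat := fun S σ => ((mooreLeaders σ).map fun a =>
      if a ∈ S then (((mooreCycleProd X σ a).re : ℂ) : CQuat) else mooreCycleProd X σ a).prod
      with hP
    -- This sign-preserving involution reverses the cycle led by `a`, if there is one. Averaging
    -- over it turns that cycle product into its scalar part.
    set ρ : Perm (Fin n) → Perm (Fin n) := fun σ =>
      if a ∈ mooreLeaders σ then revCycle σ a else σ with hρ
    have hρρ : Function.Involutive ρ := by
      intro σ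
      by_cases h : a ∈ mooreLeaders σ
      · simp [hρ, h, mooreLeaders_revCycle, revCycle_revCycle]
      · simp [hρ, h]
    have hsign : ∀ σ, sign (ρ σ) = sign σ := by
      intro σ
      by_cases h : a ∈ mooreLeaders σ
      · simp [hρ, h, sign_revCycle]
      · simp [hρ, h]
    have key : ∀ σ, P (insert a S) σ = ((2⁻¹ : ℂ) : CQuat) * (P S σ + P S (ρ σ)) := by
      intro σ
      by_cases h : a ∈ mooreLeaders σ
      · simp only [hρ, h, if_true, hP, mooreLeaders_revCycle]
        refine prod_map_average (nodup_mooreLeaders σ) h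
          (Quaternion.coe_commutes _) ?_ ?_ ?_
        · simp only [Finset.mem_insert_self, if_true, haS, if_false, mooreCycleProd_revCycle hX]
          exact coe_re_eq_average _
        · intro b hb
          simp [hb]
        · intro b hbl hb
          have : ¬ σ.SameCycle a b := fun hab => hb (le_antisymm
            (mem_mooreLeaders.1 h b hab) (mem_mooreLeaders.1 hbl a hab.symm))
          simp [hb, mooreCycleProd_revCycle_of_not_sameCycle X this]
      · have hS : P (insert a S) σ = P S σ := by
          refine congrArg List.prod (List.map_congr_left fun b hb => ?_)
          have : b ≠ a := fun hba => h (hba ▸ hb)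
          simp [this]
        simp only [hρ, h, if_false, hS]
        rw [coe_half_mul_add_self]
    have hsum : ∑ σ, (sign σ : ℤ) • P S (ρ σ) = ∑ σ, (sign σ : ℤ) • P S σ := by
      refine Fintype.sum_equiv hρρ.toPerm _ _ fun σ => ?_
      simp [hsign]
    rw [ih]
    change _ = ∑ σ, (sign σ : ℤ) • P (insert a S) σ
    simp only [key, ← mul_smul_comm, smul_add]
    rw [← Finset.mul_sum, Finset.sum_add_distrib, hsum, coe_half_mul_add_self]

/-- The Moore–Dyson determinant of a self-dual matrix is a scalar. -/
theorem mooreDet_eq_cycleExpansion {X : Matrix (Fin n) (Fin n) CQuat}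
    (hX : ∀ i j, X j i = star (X i j)) :
    mooreDet X = ((cycleExpansion fun i j => quatMatrix (X i j) : ℂ) : CQuat) := by
  have hc : ∀ z : ℂ, (z : CQuat) = algebraMap ℂ CQuat z := fun _ => rfl
  rw [mooreDet_eq_sum_re hX Finset.univ, cycleExpansion, hc, map_sum]
  refine Finset.sum_congr rfl fun σ _ => ?_
  rw [loopSum_eq_prod_trace, cycleWeight_eq_prod_leaders, mul_assoc, ← List.prod_map_mul, map_mul,
    map_list_prod, List.map_map, zsmul_eq_mul]
  refine congrArg₂ _ ?_ ?_
  · simp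
  · refine congrArg List.prod (List.map_congr_left fun a _ => ?_)
    have : ((List.range (Function.minimalPeriod σ a)).map fun t =>
        quatMatrix (X ((σ ^ t) a) ((σ ^ (t + 1)) a))).prod =
        quatMatrix (mooreCycleProd X σ a) := by
      rw [mooreCycleProd, map_list_prod, List.map_map]
      rfl
    simp only [Finset.mem_univ, if_true, Function.comp_apply, this, trace_quatMatrix, hc]
    congr 1
    ring

end MooreDetExpansion

/-! ### Correlation functions of the projection kernel -/

section Factor

open Equiv

variable {I S M : Type*} [Fintype I] [DecidableEq I] [Fintype S] [Fintype M]

/-- This is cyclicity of the trace on all cycles at once: exchange the two index sums and shift one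
along `σ`. -/
theorem loopSum_mul_comm (U : I → Matrix S M ℂ) (V : I → Matrix M S ℂ) (σ : Perm I) :
    loopSum (fun i j => U i * V j) σ = loopSum (fun l _ => V l * U l) σ := by
  unfold loopSum
  simp only [Matrix.mul_apply, Finset.prod_univ_sum, Fintype.piFinset_univ]
  rw [Finset.sum_comm, ← (σ.symm.arrowCongr (Equiv.refl M)).sum_comp]
  refine Finset.sum_congr rfl fun κ _ => Finset.sum_congr rfl fun s _ => ?_
  simp only [Finset.prod_mul_distrib, Equiv.arrowCongr_apply, Equiv.symm_symm, Equiv.coe_refl,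
    Function.comp_apply, id_eq]
  rw [mul_comm, Equiv.prod_comp σ fun x => V x (κ x) (s x)]

end Factor

/-! ### Summing out points that carry the identity -/

section CycleExpansionRecursion

open Equiv

variable {M : Type*} [Fintype M] [DecidableEq M]

theorem cycleExpansion_fin_succ {m : ℕ} (g : ℕ → Matrix M M ℂ) (hg : g m = 1) :
    cycleExpansion (fun (l _ : Fin (m + 1)) => g l) =
      ((Fintype.card M : ℂ) / 2 - m) * cycleExpansion fun (l _ : Fin m) => g l := by
  have h := cycleExpansion_reindex finSuccEquivLast.symm fun (l _ : Fin (m + 1)) => g l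
  rw [← h, cycleExpansion_option (fun l : Option (Fin m) => g (finSuccEquivLast.symm l))
    (by simpa using hg)]
  simp

/-- Summing out the points at which the matrices are the identity. -/
theorem cycleExpansion_fin_add {N m : ℕ} (hM : Fintype.card M = N * 2) (hm : m ≤ N) (k : ℕ)
    (g : ℕ → Matrix M M ℂ) (hg : ∀ l, m ≤ l → g l = 1) :
    cycleExpansion (fun (l _ : Fin (m + k)) => g l) =
      (N - m).descFactorial k * cycleExpansion fun (l _ : Fin m) => g l := by
  induction k with
  | zero => simp
  | succ k ih =>
    refine (cycleExpansion_fin_succ g (hg _ (Nat.le_add_right m k))).trans ?_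
    rw [ih, Nat.descFactorial_succ, ← mul_assoc]
    congr 1
    -- Beyond `N` the truncated subtraction no longer matches the factor, but the falling factorial
    -- is already zero.
    rcases le_or_gt (m + k) N with h | h
    · rw [hM]
      push_cast [Nat.cast_sub (show k ≤ N - m by omega), Nat.cast_sub hm]
      ring
    · rw [Nat.descFactorial_eq_zero_iff_lt.2 (by omega)]
      simp

theorem cycleExpansion_one {N : ℕ} (hM : Fintype.card M = N * 2) (n : ℕ) :
    cycleExpansion (fun (_ _ : Fin n) => (1 : Matrix M M ℂ)) = N.descFactorial n := by
  have h := cycleExpansion_fin_add hM (Nat.zero_le N) n (fun _ => 1) fun _ _ => rfl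
  rw [cycleExpansion_of_isEmpty (I := Fin 0), Nat.sub_zero, mul_one] at h
  rw [← h, ← cycleExpansion_reindex (finCongr (Nat.zero_add n))]

end CycleExpansionRecursion

/-! ### The Gram matrix and its integrals -/

section Gram

variable {Λ : Type*} {N : ℕ}

/-- The matrix form of the quaternion Gram matrix `u_k^* (x) u_l (x)`. -/
noncomputable def gramMatrix (u : Fin N → Λ → CQuat) (x : Λ) :
    Matrix (Fin N × Fin 2) (Fin N × Fin 2) ℂ :=
  Matrix.of fun p q => quatMatrix (star (u p.1 x) * u q.1 x) p.2 q.2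

/-- The correlation function of the projection kernel, as a sum over permutations. -/
noncomputable def projectionCorrelation (u : Fin N → Λ → CQuat) {I : Type*} [Fintype I]
    [DecidableEq I] (x : I → Λ) : ℂ :=
  cycleExpansion fun l _ => gramMatrix u (x l)

theorem isSelfDualKernel_projectionKernel (u : Fin N → Λ → CQuat) :
    IsSelfDualKernel (projectionKernel u) := by
  intro x y
  refine Eq.trans (Finset.sum_congr rfl fun k _ => ?_)
    (star_sum Finset.univ fun k => u k x * star (u k y)).symm
  rw [star_mul, star_star]

theorem projectionCorrelation_eq {I : Type*} [Fintype I] [DecidableEq I]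
    (u : Fin N → Λ → CQuat) (x : I → Λ) :
    projectionCorrelation u x =
      cycleExpansion fun i j => quatMatrix (projectionKernel u (x i) (x j)) := by
  set U : I → Matrix (Fin 2) (Fin N × Fin 2) ℂ :=
    fun i => Matrix.of fun s p => quatMatrix (u p.1 (x i)) s p.2 with hU
  set V : I → Matrix (Fin N × Fin 2) (Fin 2) ℂ :=
    fun i => Matrix.of fun p s => quatMatrix (star (u p.1 (x i))) p.2 s with hV
  have h1 : ∀ i j, quatMatrix (projectionKernel u (x i) (x j)) = U i * V j := by
    intro i j
    ext s t
    simp [projectionKernel, map_sum, map_mul, Matrix.sum_apply, Matrix.mul_apply, hU, hV,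
      Fintype.sum_prod_type]
  have h2 : ∀ i, gramMatrix u (x i) = V i * U i := by
    intro i
    ext p q
    simp [gramMatrix, map_mul, Matrix.mul_apply, hU, hV]
  simp only [projectionCorrelation, cycleExpansion, h1, h2, loopSum_mul_comm]

theorem mooreDet_kernelMatrix_projectionKernel (u : Fin N → Λ → CQuat) {n : ℕ} (x : Fin n → Λ) :
    mooreDet (kernelMatrix (projectionKernel u) x) = ((projectionCorrelation u x : ℂ) : CQuat) := by
  rw [projectionCorrelation_eq]
  exact mooreDet_eq_cycleExpansion (X := kernelMatrix (projectionKernel u) x)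
    fun i j => isSelfDualKernel_projectionKernel u (x i) (x j)

/-- Coinciding points give the kernel matrix two equal rows. -/
theorem projectionCorrelation_eq_zero (u : Fin N → Λ → CQuat) {I : Type*} [Fintype I]
    [DecidableEq I] {x : I → Λ} (hx : ¬ Function.Injective x) : projectionCorrelation u x = 0 := by
  obtain ⟨i, j, hij, hne⟩ : ∃ i j, x i = x j ∧ i ≠ j := by
    simpa [Function.Injective] using hx
  rw [projectionCorrelation_eq]
  refine cycleExpansion_eq_zero (fun i j => ?_) hne fun l => by rw [hij]
  rw [isSelfDualKernel_projectionKernel u (x i) (x j), quatMatrix_star]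

variable [MeasurableSpace Λ] {μ : Measure Λ}

/-- The integral of the Gram matrix over a set. -/
noncomputable def gramIntegral (u : Fin N → Λ → CQuat) (μ : Measure Λ) (B : Set Λ) :
    Matrix (Fin N × Fin 2) (Fin N × Fin 2) ℂ :=
  Matrix.of fun p q => ∫ x in B, gramMatrix u x p q ∂μ

variable {u : Fin N → Λ → CQuat}

theorem integrable_quatMatrix {f : Λ → CQuat} (hf : CQuat.IsIntegrable f μ) (s t : Fin 2) :
    Integrable (fun x => quatMatrix (f x) s t) μ := by
  have h1 := hf.re
  have h2 := hf.imI.mul_const Complex.I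
  have h3 := hf.imJ
  have h4 := hf.imK.mul_const Complex.I
  fin_cases s <;> fin_cases t
  · exact h1.add h2
  · exact h3.add h4
  · exact h3.neg.add h4
  · exact h1.sub h2

theorem integral_quatMatrix {f : Λ → CQuat} (hf : CQuat.IsIntegrable f μ) (s t : Fin 2) :
    ∫ x, quatMatrix (f x) s t ∂μ = quatMatrix (CQuat.integral f μ) s t := by
  have h1 := hf.re
  have h2 := hf.imI.mul_const Complex.I
  have h3 := hf.imJ
  have h4 := hf.imK.mul_const Complex.I
  fin_cases s <;> fin_cases t
  · exact (integral_add h1 h2).trans (by rw [integral_mul_const]; rfl)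
  · exact (integral_add h3 h4).trans (by rw [integral_mul_const]; rfl)
  · exact (integral_add h3.neg h4).trans (by rw [integral_mul_const, integral_neg']; rfl)
  · exact (integral_sub h1 h2).trans (by rw [integral_mul_const]; rfl)

theorem integrable_gramMatrix (hu : CQuat.IsOrthonormal u μ) (p q : Fin N × Fin 2) :
    Integrable (fun x => gramMatrix u x p q) μ :=
  integrable_quatMatrix (hu.integrable p.1 q.1) p.2 q.2

theorem gramIntegral_univ (hu : CQuat.IsOrthonormal u μ) : gramIntegral u μ Set.univ = 1 := by
  ext ⟨k, s⟩ ⟨l, t⟩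
  have h : gramIntegral u μ Set.univ (k, s) (l, t) =
      ∫ x, quatMatrix (star (u k x) * u l x) s t ∂μ := by
    simp [gramIntegral, gramMatrix]
  rw [h, integral_quatMatrix (hu.integrable k l), hu.integral_eq]
  by_cases hkl : k = l
  · subst hkl
    simp [Matrix.one_apply]
  · simp [hkl]

theorem measurable_gramMatrix (hu : CQuat.IsOrthonormal u μ) (p q : Fin N × Fin 2) :
    Measurable fun x => gramMatrix u x p q := by
  have h1 := hu.measurable p.1
  have h2 := hu.measurable q.1
  have := h1.re
  have := h1.imI
  have := h1.imJ
  have := h1.imK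
  have := h2.re
  have := h2.imI
  have := h2.imJ
  have := h2.imK
  obtain ⟨k, s⟩ := p
  obtain ⟨l, t⟩ := q
  simp only [gramMatrix, Matrix.of_apply, quatMatrix_apply]
  fin_cases s <;> fin_cases t <;> simp <;> fun_prop

variable {I : Type*} [Fintype I] [DecidableEq I]

theorem measurable_projectionCorrelation (hu : CQuat.IsOrthonormal u μ) :
    Measurable fun x : I → Λ => projectionCorrelation u x := by
  unfold projectionCorrelation cycleExpansion loopSum
  refine Finset.measurable_fun_sum _ fun σ _ => Measurable.const_mul ?_ _
  refine Finset.measurable_fun_sum _ fun s _ => Finset.measurable_fun_prod _ fun l _ => ?_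
  exact (measurable_gramMatrix hu _ _).comp (measurable_pi_apply l)

theorem integrable_projectionCorrelation [SigmaFinite μ] (hu : CQuat.IsOrthonormal u μ) :
    Integrable (fun x : I → Λ => projectionCorrelation u x) (Measure.pi fun _ => μ) := by
  unfold projectionCorrelation cycleExpansion loopSum
  refine integrable_finsetSum _ fun σ _ => Integrable.const_mul ?_ _
  refine integrable_finsetSum _ fun s _ => ?_
  exact Integrable.fintype_prod (f := fun l y => gramMatrix u y (s l) (s (σ l)))
    fun l => integrable_gramMatrix hu _ _

/-- Every term is a product of functions of one coordinate each, so Fubini integrates the matrices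
separately. -/
theorem integral_projectionCorrelation [SigmaFinite μ] (hu : CQuat.IsOrthonormal u μ)
    (B : I → Set Λ) :
    ∫ x in Set.univ.pi B, projectionCorrelation u x ∂(Measure.pi fun _ => μ) =
      cycleExpansion fun l _ => gramIntegral u μ (B l) := by
  have hint : ∀ (σ : Equiv.Perm I) (s : I → Fin N × Fin 2),
      Integrable (fun x : I → Λ => ∏ l, gramMatrix u (x l) (s l) (s (σ l)))
        (Measure.pi fun l => μ.restrict (B l)) := fun σ s =>
    Integrable.fintype_prod_dep (f := fun l y => gramMatrix u y (s l) (s (σ l)))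
      fun l => (integrable_gramMatrix hu _ _).restrict
  rw [Measure.restrict_pi_pi]
  unfold projectionCorrelation cycleExpansion loopSum
  rw [integral_finsetSum _ fun σ _ =>
    Integrable.const_mul (integrable_finsetSum _ fun s _ => hint σ s) _]
  refine Finset.sum_congr rfl fun σ _ => ?_
  rw [integral_const_mul, integral_finsetSum _ fun s _ => hint σ s]
  congr 1
  refine Finset.sum_congr rfl fun s _ => ?_
  exact integral_fintype_prod_eq_prod fun l y => gramMatrix u y (s l) (s (σ l))

end Gram

/-! ### Falling factorials as numbers of injections -/

section Counting

theorem fallingFactorial_natCast (c k : ℕ) :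
    fallingFactorial (c : ℕ∞) k = (c.descFactorial k : ℕ) := by
  unfold fallingFactorial
  induction k with
  | zero => simp
  | succ k ih =>
    rw [Finset.prod_range_succ, ih, Nat.descFactorial_succ, mul_comm]
    push_cast
    rfl

/-- Injections of a disjoint union that respect the blocks are families of injections. -/
noncomputable def blockEmbeddingEquiv {m n N : ℕ} {k : Fin m → ℕ} (e : (Σ i, Fin (k i)) ≃ Fin n)
    (T : Fin m → Set (Fin N)) (hT : Pairwise fun i j => Disjoint (T i) (T j)) :
    {f : Fin n ↪ Fin N // ∀ i j, f (e ⟨i, j⟩) ∈ T i} ≃ ∀ i, Fin (k i) ↪ T i where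
  toFun f i := ⟨fun j => ⟨f.1 (e ⟨i, j⟩), f.2 i j⟩, fun j j' h => by simpa using h⟩
  invFun f := ⟨⟨fun l => f (e.symm l).1 (e.symm l).2, fun l l' h => by
      have h' : ((f (e.symm l).1 (e.symm l).2 : T _) : Fin N) =
        (f (e.symm l').1 (e.symm l').2 : T _) := h
      apply e.symm.injective
      generalize e.symm l = a at h'
      generalize e.symm l' = b at h'
      obtain ⟨i, j⟩ := a
      obtain ⟨i', j'⟩ := b
      obtain rfl : i = i' := by
        by_contra hne
        exact Set.disjoint_left.1 (hT hne) (f i j).2 (by simp only at h'; rw [h']; exact (f i' j').2)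
      exact congrArg _ ((f i).injective (Subtype.ext h'))⟩, fun i j => by
      change ((f (e.symm (e ⟨i, j⟩)).1 (e.symm (e ⟨i, j⟩)).2 : T _) : Fin N) ∈ T i
      generalize h : e.symm (e ⟨i, j⟩) = a
      obtain rfl : ⟨i, j⟩ = a := by rw [← h, e.symm_apply_apply]
      exact (f i j).2⟩
  left_inv f := by
    refine Subtype.ext (DFunLike.ext _ _ fun l => ?_)
    change f.1 (e ⟨(e.symm l).1, (e.symm l).2⟩) = f.1 l
    rw [Sigma.eta, e.apply_symm_apply]
  right_inv f := by
    refine funext fun i => DFunLike.ext _ _ fun j => Subtype.ext ?_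
    change ((f (e.symm (e ⟨i, j⟩)).1 (e.symm (e ⟨i, j⟩)).2 : T _) : Fin N) = f i j
    generalize h : e.symm (e ⟨i, j⟩) = a
    obtain rfl : ⟨i, j⟩ = a := by rw [← h, e.symm_apply_apply]
    rfl

variable {Λ : Type*}

theorem prod_fallingFactorial_range_inter {m n N : ℕ} {x : Fin N → Λ} (hx : Function.Injective x)
    (A : Fin m → Set Λ) (hA : Pairwise fun i j => Disjoint (A i) (A j)) (k : Fin m → ℕ)
    (hk : ∑ i, k i = n) :
    ∏ i, fallingFactorial (Set.range x ∩ A i).encard (k i) =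
      (Nat.card {f : Fin n ↪ Fin N // x ∘ f ∈ blockSet A k hk} : ℕ) := by
  classical
  have h1 : ∀ i, (Set.range x ∩ A i).encard = (Nat.card (x ⁻¹' A i) : ℕ) := by
    intro i
    rw [Set.inter_comm, ← Set.image_preimage_eq_inter_range, hx.encard_image,
      ← Set.coe_fintypeCard, Nat.card_eq_fintype_card]
  have h2 := Nat.card_congr (blockEmbeddingEquiv (finSigmaFinEquiv.trans (finCongr hk))
    (fun i => x ⁻¹' A i) fun i j hij => (hA hij).preimage x)
  simp only [h1, fallingFactorial_natCast]
  rw [← Nat.cast_prod]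
  congr 1
  refine Eq.trans ?_ h2.symm
  rw [Nat.card_pi]
  refine Finset.prod_congr rfl fun i _ => ?_
  rw [Nat.card_eq_fintype_card, Nat.card_eq_fintype_card, Fintype.card_embedding_eq,
    Fintype.card_fin]

theorem blockSet_eq_pi {m n : ℕ} (A : Fin m → Set Λ) (k : Fin m → ℕ) (hk : ∑ i, k i = n) :
    blockSet A k hk =
      Set.univ.pi fun l => A ((finSigmaFinEquiv.trans (finCongr hk)).symm l).1 := by
  ext x
  simp only [blockSet, Set.mem_ofPred_eq, Set.mem_univ_pi]
  constructor
  · intro h l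
    have := h _ ((finSigmaFinEquiv.trans (finCongr hk)).symm l).2
    convert this
    exact ((finSigmaFinEquiv.trans (finCongr hk)).apply_symm_apply l).symm
  · intro h i j
    have := h ((finSigmaFinEquiv.trans (finCongr hk)) ⟨i, j⟩)
    rwa [Equiv.symm_apply_apply] at this

end Counting

/-! ### Measurability through counts -/

section Measurability

variable {Λ : Type*} [MeasurableSpace Λ]

theorem PointConfiguration.measurable_count {A : Set Λ} (hA : MeasurableSet A) :
    Measurable fun S : PointConfiguration Λ => S.count A :=
  measurable_to_countable' fun c => MeasurableSpace.measurableSet_generateFrom ⟨A, hA, c, rfl⟩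

theorem PointConfiguration.measurable_of_count {X : Type*} [MeasurableSpace X]
    {f : X → PointConfiguration Λ}
    (hf : ∀ A, MeasurableSet A → Measurable fun x => (f x).count A) : Measurable f := by
  refine measurable_generateFrom ?_
  rintro _ ⟨A, hA, c, rfl⟩
  exact hf A hA (measurableSet_singleton c)

theorem PointConfiguration.measurable_prod_fallingFactorial {m : ℕ} {A : Fin m → Set Λ}
    (hA : ∀ i, MeasurableSet (A i)) (k : Fin m → ℕ) :
    Measurable fun S : PointConfiguration Λ =>
      ((∏ i, fallingFactorial (S.count (A i)) (k i) : ℕ∞) : ℝ≥0∞) := by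
  have h : Measurable fun S : PointConfiguration Λ => fun i => S.count (A i) :=
    measurable_pi_lambda _ fun i => PointConfiguration.measurable_count (hA i)
  exact (measurable_of_countable fun c : Fin m → ℕ∞ =>
    ((∏ i, fallingFactorial (c i) (k i) : ℕ∞) : ℝ≥0∞)).comp h

end Measurability

/-! ### Masses and marginals of the correlation functions -/

section CorrelationMass

variable {Λ : Type*} {N : ℕ} {u : Fin N → Λ → CQuat}

theorem exists_projectionCorrelation_eq (hpos : IsPositiveKernel (projectionKernel u)) {n : ℕ}
    (x : Fin n → Λ) : ∃ r : ℝ, 0 ≤ r ∧ projectionCorrelation u x = r := by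
  rcases Nat.eq_zero_or_pos n with rfl | hn
  -- Positivity is assumed only for `m ≥ 1`; the empty expansion is `1`.
  · exact ⟨1, zero_le_one, by simp [projectionCorrelation, cycleExpansion_of_isEmpty]⟩
  · obtain ⟨r, hr, h⟩ := hpos n hn x
    rw [mooreDet_kernelMatrix_projectionKernel] at h
    exact ⟨r, hr, Quaternion.coe_injective h⟩

/-- The correlation functions of a positive projection kernel are real. -/
theorem ofReal_re_projectionCorrelation (hpos : IsPositiveKernel (projectionKernel u)) {n : ℕ}
    (x : Fin n → Λ) : ((projectionCorrelation u x).re : ℂ) = projectionCorrelation u x := by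
  obtain ⟨r, -, h⟩ := exists_projectionCorrelation_eq hpos x
  rw [h, Complex.ofReal_re]

theorem re_projectionCorrelation_nonneg (hpos : IsPositiveKernel (projectionKernel u)) {n : ℕ}
    (x : Fin n → Λ) : 0 ≤ (projectionCorrelation u x).re := by
  obtain ⟨r, hr, h⟩ := exists_projectionCorrelation_eq hpos x
  rw [h, Complex.ofReal_re]
  exact hr

variable [MeasurableSpace Λ] {μ : Measure Λ}

theorem measurable_ofReal_projectionCorrelation (hu : CQuat.IsOrthonormal u μ) (n : ℕ) :
    Measurable fun x : Fin n → Λ => ENNReal.ofReal (projectionCorrelation u x).re :=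
  (Complex.measurable_re.comp (measurable_projectionCorrelation hu)).ennreal_ofReal

theorem card_gramIndex (N : ℕ) : Fintype.card (Fin N × Fin 2) = N * 2 := by simp

variable [SigmaFinite μ]

theorem lintegral_pi_projectionCorrelation (hu : CQuat.IsOrthonormal u μ)
    (hpos : IsPositiveKernel (projectionKernel u)) {n : ℕ} (B : Fin n → Set Λ) :
    ∫⁻ x in Set.univ.pi B, ENNReal.ofReal (projectionCorrelation u x).re
        ∂(Measure.pi fun _ => μ) =
      ENNReal.ofReal (cycleExpansion fun l _ => gramIntegral u μ (B l)).re := by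
  have hint := (integrable_projectionCorrelation (I := Fin n) hu).restrict (s := Set.univ.pi B)
  rw [← integral_projectionCorrelation hu]
  exact (ofReal_integral_eq_lintegral_ofReal hint.re (Filter.Eventually.of_forall fun x =>
    re_projectionCorrelation_nonneg hpos x)).symm.trans (congrArg ENNReal.ofReal (integral_re hint))

theorem lintegral_projectionCorrelation (hu : CQuat.IsOrthonormal u μ)
    (hpos : IsPositiveKernel (projectionKernel u)) (n : ℕ) :
    ∫⁻ x : Fin n → Λ, ENNReal.ofReal (projectionCorrelation u x).re ∂(Measure.pi fun _ => μ) =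
      (N.descFactorial n : ℕ) := by
  have h := lintegral_pi_projectionCorrelation hu hpos fun _ : Fin n => Set.univ
  rw [Set.pi_univ, Measure.restrict_univ] at h
  rw [h]
  simp only [gramIntegral_univ hu]
  rw [cycleExpansion_one (card_gramIndex N), Complex.natCast_re, ENNReal.ofReal_natCast]

/-- The set of labelled configurations whose points selected by `f` lie in given sets carries the
same mass for all injections `f`. -/
theorem lintegral_selected (hu : CQuat.IsOrthonormal u μ)
    (hpos : IsPositiveKernel (projectionKernel u)) {n : ℕ} (f : Fin n ↪ Fin N)
    (B : Fin n → Set Λ) :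
    ∫⁻ x in {x : Fin N → Λ | x ∘ f ∈ Set.univ.pi B},
        ENNReal.ofReal (projectionCorrelation u x).re ∂(Measure.pi fun _ => μ) =
      ((N - n).factorial : ℕ) * ∫⁻ x in Set.univ.pi B,
        ENNReal.ofReal (projectionCorrelation u x).re ∂(Measure.pi fun _ => μ) := by
  classical
  have hn : n ≤ N := by simpa using Fintype.card_le_of_embedding f
  obtain ⟨π, hπ⟩ := Equiv.Perm.exists_extending_pair (Fin.castLE hn) f
    (Fin.castLE_injective hn) f.injective
  -- After `π` moves the selected labels to the front, the remaining coordinates are unconstrained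
  -- and their Gram integrals are `1`.
  set B' : ℕ → Set Λ := fun l => if h : l < n then B ⟨l, h⟩ else Set.univ with hB'
  have hset : {x : Fin N → Λ | x ∘ f ∈ Set.univ.pi B} =
      Set.univ.pi fun l => B' (π.symm l) := by
    ext x
    simp only [Set.mem_ofPred_eq, Set.mem_univ_pi, Function.comp_apply]
    constructor
    · intro h l
      obtain ⟨m, rfl⟩ := π.surjective l
      rw [Equiv.symm_apply_apply]
      by_cases hm : (m : ℕ) < n
      · have := h ⟨m, hm⟩
        rw [← hπ] at this
        simpa [hB', hm] using this
      · simp [hB', hm]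
    · intro h i
      have := h (π (Fin.castLE hn i))
      rw [Equiv.symm_apply_apply, hπ] at this
      simpa [hB'] using this
  have h1 : ∀ l : Fin n, B' l = B l := fun l => by simp [hB']
  have h2 := cycleExpansion_fin_add (card_gramIndex N) hn (N - n)
    (fun l => gramIntegral u μ (B' l)) fun l hl => by
      simp [hB', not_lt.2 hl, gramIntegral_univ hu]
  have h3 := cycleExpansion_reindex (finCongr (Nat.add_sub_cancel' hn))
    fun l _ : Fin N => gramIntegral u μ (B' l)
  have h4 := cycleExpansion_reindex π.symm fun l _ : Fin N => gramIntegral u μ (B' l)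
  simp only [finCongr_apply, Fin.val_cast] at h3
  rw [hset, lintegral_pi_projectionCorrelation hu hpos, lintegral_pi_projectionCorrelation hu hpos,
    h4, ← h3, h2, Nat.descFactorial_self]
  simp only [h1]
  rw [← Complex.ofReal_natCast, Complex.re_ofReal_mul, ENNReal.ofReal_mul (Nat.cast_nonneg _),
    ENNReal.ofReal_natCast]

end CorrelationMass

/-! ### Construction of the field -/

section Existence

variable {Λ : Type*} {N : ℕ} {u : Fin N → Λ → CQuat}

open Classical in
/-- The configuration of the points `x_1, …, x_N`; it is empty where the correlation function of
order `N` vanishes. -/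
noncomputable def labelledConfiguration (u : Fin N → Λ → CQuat) (x : Fin N → Λ) :
    PointConfiguration Λ :=
  ⟨if projectionCorrelation u x = 0 then ∅ else Set.range x,
    ((Set.finite_range x).subset (by split_ifs <;> simp)).countable⟩

theorem count_labelledConfiguration_of_eq_zero {x : Fin N → Λ}
    (hx : projectionCorrelation u x = 0) (A : Set Λ) :
    (labelledConfiguration u x).count A = 0 := by
  simp [PointConfiguration.count, labelledConfiguration, hx]

theorem count_labelledConfiguration {x : Fin N → Λ}
    (hx : projectionCorrelation u x ≠ 0) (A : Set Λ) :
    (labelledConfiguration u x).count A = (Set.range x ∩ A).encard := by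
  simp [PointConfiguration.count, labelledConfiguration, hx]

theorem injective_of_projectionCorrelation_ne_zero {x : Fin N → Λ}
    (hx : projectionCorrelation u x ≠ 0) : Function.Injective x := by
  by_contra h
  exact hx (projectionCorrelation_eq_zero u h)

theorem density_mul_prod_fallingFactorial {m n : ℕ}
    (A : Fin m → Set Λ) (hA : Pairwise fun i j => Disjoint (A i) (A j)) (k : Fin m → ℕ)
    (hk : ∑ i, k i = n) (x : Fin N → Λ) :
    ENNReal.ofReal (projectionCorrelation u x).re *
      ((∏ i, fallingFactorial ((labelledConfiguration u x).count (A i)) (k i) : ℕ∞) : ℝ≥0∞) =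
    ∑ f : Fin n ↪ Fin N, {x : Fin N → Λ | x ∘ f ∈ blockSet A k hk}.indicator
      (fun x => ENNReal.ofReal (projectionCorrelation u x).re) x := by
  classical
  by_cases hx : projectionCorrelation u x = 0
  · simp [hx, Set.indicator_apply]
  · have h := prod_fallingFactorial_range_inter
      (injective_of_projectionCorrelation_ne_zero hx) A hA k hk
    simp only [count_labelledConfiguration hx, h, Set.indicator_apply, Set.mem_ofPred_eq]
    rw [← Finset.sum_filter, Finset.sum_const, nsmul_eq_mul, mul_comm, Nat.card_eq_fintype_card,
      Fintype.card_subtype, ENat.toENNReal_coe]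

variable [MeasurableSpace Λ] {μ : Measure Λ}

/-- Off the zero set of the correlation function the points are distinct, so a count is a sum of
indicators over labels. -/
theorem measurable_labelledConfiguration (hu : CQuat.IsOrthonormal u μ) :
    Measurable (labelledConfiguration u) := by
  classical
  refine PointConfiguration.measurable_of_count fun A hA => ?_
  have h : ∀ x : Fin N → Λ, (labelledConfiguration u x).count A =
      if projectionCorrelation u x = 0 then 0
      else ((∑ l, if x l ∈ A then 1 else 0 : ℕ) : ℕ∞) := by
    intro x
    split_ifs with hx
    · exact count_labelledConfiguration_of_eq_zero hx A
    · have hset : x ⁻¹' A = ((Finset.univ.filter fun l => x l ∈ A : Finset (Fin N)) : Set _) := by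
        ext l
        simp
      rw [count_labelledConfiguration hx, Set.inter_comm, ← Set.image_preimage_eq_inter_range,
        (injective_of_projectionCorrelation_ne_zero hx).encard_image, hset,
        Set.encard_coe_eq_coe_finsetCard, Finset.card_filter]
  simp only [h]
  refine Measurable.ite (measurable_projectionCorrelation hu (measurableSet_singleton 0))
    measurable_const (measurable_from_top.comp ?_)
  exact Finset.measurable_fun_sum _ fun l _ =>
    Measurable.ite (measurable_pi_apply l hA) measurable_const measurable_const

variable [SigmaFinite μ]

/-- The law of the point field with the given projection kernel: `N` labelled points with density
`R_N / N!`, with the labels forgotten. -/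
noncomputable def projectionPointField (u : Fin N → Λ → CQuat) (μ : Measure Λ) [SigmaFinite μ] :
    Measure (PointConfiguration Λ) :=
  (((N.factorial : ℝ≥0∞)⁻¹ • (Measure.pi fun _ : Fin N => μ)).withDensity
    fun x => ENNReal.ofReal (projectionCorrelation u x).re).map (labelledConfiguration u)

theorem factorial_inv_mul (N : ℕ) : ((N.factorial : ℝ≥0∞)⁻¹) * (N.factorial : ℝ≥0∞) = 1 :=
  ENNReal.inv_mul_cancel (by exact_mod_cast N.factorial_ne_zero) (ENNReal.natCast_ne_top _)

theorem lintegral_projectionPointField (hu : CQuat.IsOrthonormal u μ)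
    {F : PointConfiguration Λ → ℝ≥0∞} (hF : Measurable F) :
    ∫⁻ S, F S ∂(projectionPointField u μ) =
      (N.factorial : ℝ≥0∞)⁻¹ * ∫⁻ x : Fin N → Λ, ENNReal.ofReal (projectionCorrelation u x).re *
        F (labelledConfiguration u x) ∂(Measure.pi fun _ => μ) := by
  rw [projectionPointField, lintegral_map hF (measurable_labelledConfiguration hu)]
  refine (lintegral_withDensity_eq_lintegral_mul _ (measurable_ofReal_projectionCorrelation hu N)
    (hF.comp (measurable_labelledConfiguration hu))).trans ?_
  rw [lintegral_smul_measure]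
  rfl

theorem isProbabilityMeasure_projectionPointField (hu : CQuat.IsOrthonormal u μ)
    (hpos : IsPositiveKernel (projectionKernel u)) :
    IsProbabilityMeasure (projectionPointField u μ) := by
  constructor
  rw [← lintegral_one, lintegral_projectionPointField hu measurable_const]
  simp only [mul_one]
  rw [lintegral_projectionCorrelation hu hpos, Nat.descFactorial_self, factorial_inv_mul]

/-- Each of the `N! / (N - n)!` injections contributes `(N - n)!` times the integral of `R_n`, which
cancels the normalisation `1 / N!`. -/
theorem isCorrelationFunction_projectionPointField (hu : CQuat.IsOrthonormal u μ)
    (hpos : IsPositiveKernel (projectionKernel u)) (n : ℕ) :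
    IsCorrelationFunction μ (projectionPointField u μ) n
      fun x => (projectionCorrelation u x).re where
  nonneg x := re_projectionCorrelation_nonneg hpos x
  integrableOn B _ _ := (integrable_projectionCorrelation hu).re.integrableOn
  expectation_eq m A k hk hA hdisj := by
    have hmeas : MeasurableSet (blockSet A k hk) := by
      rw [blockSet_eq_pi]
      exact MeasurableSet.univ_pi fun l => hA _
    have hsel : ∀ f : Fin n ↪ Fin N, MeasurableSet {x : Fin N → Λ | x ∘ f ∈ blockSet A k hk} :=
      fun f => (measurable_pi_lambda (fun x : Fin N → Λ => x ∘ f)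
        fun i => measurable_pi_apply (f i)) hmeas
    rw [lintegral_projectionPointField hu
      (PointConfiguration.measurable_prod_fallingFactorial hA k)]
    simp only [density_mul_prod_fallingFactorial A hdisj k hk]
    rw [lintegral_finsetSum _ fun f _ =>
      (measurable_ofReal_projectionCorrelation hu N).indicator (hsel f)]
    simp only [lintegral_indicator (hsel _)]
    rw [blockSet_eq_pi]
    simp only [lintegral_selected hu hpos]
    rw [Finset.sum_const, Finset.card_univ, Fintype.card_embedding_eq, Fintype.card_fin,
      Fintype.card_fin, nsmul_eq_mul, ← mul_assoc, ← mul_assoc]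
    rcases le_or_gt n N with h | h
    · rw [mul_assoc _ ((N.descFactorial n : ℕ) : ℝ≥0∞), ← Nat.cast_mul, mul_comm (N.descFactorial n),
        Nat.factorial_mul_descFactorial h, factorial_inv_mul, one_mul]
    -- For `n > N` there are no injections, and `R_n` has total mass zero.
    · rw [Nat.descFactorial_eq_zero_iff_lt.2 h, Nat.cast_zero, mul_zero, zero_mul, zero_mul]
      refine (le_antisymm ((setLIntegral_le_lintegral _ _).trans ?_) zero_le).symm
      rw [lintegral_projectionCorrelation hu hpos, Nat.descFactorial_eq_zero_iff_lt.2 h,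
        Nat.cast_zero]

theorem isPfaffianPointField_projectionPointField (hu : CQuat.IsOrthonormal u μ)
    (hpos : IsPositiveKernel (projectionKernel u)) :
    IsPfaffianPointField μ (projectionKernel u) (projectionPointField u μ) where
  isProbabilityMeasure := isProbabilityMeasure_projectionPointField hu hpos
  selfDual := isSelfDualKernel_projectionKernel u
  correlation m _ := ⟨_, isCorrelationFunction_projectionPointField hu hpos m, fun x => by
    rw [mooreDet_kernelMatrix_projectionKernel, CQuat.ofReal,
      ofReal_re_projectionCorrelation hpos]⟩

end Existence

/-! ### The total number of points -/

section NumberOfPoints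

variable {Λ : Type*} [MeasurableSpace Λ] {μ : Measure Λ} [SigmaFinite μ] {N : ℕ}
  {u : Fin N → Λ → CQuat}

theorem lintegral_fallingFactorial_count_univ (hu : CQuat.IsOrthonormal u μ)
    (hpos : IsPositiveKernel (projectionKernel u)) {P : Measure (PointConfiguration Λ)}
    (hP : IsPfaffianPointField μ (projectionKernel u) P) {n : ℕ} (hn : 1 ≤ n) :
    ∫⁻ S, ((fallingFactorial (S.count Set.univ) n : ℕ∞) : ℝ≥0∞) ∂P =
      (N.descFactorial n : ℕ) := by
  obtain ⟨R, hR, hdet⟩ := hP.correlation n hn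
  have hRe : ∀ x, R x = (projectionCorrelation u x).re := by
    intro x
    have h := hdet x
    rw [mooreDet_kernelMatrix_projectionKernel] at h
    rw [Quaternion.coe_injective h, Complex.ofReal_re]
  have h := hR.expectation_eq 1 (fun _ => Set.univ) (fun _ => n) (by simp) (by simp)
    (fun i j hij => absurd (Subsingleton.elim i j) hij)
  rw [blockSet_eq_pi, Set.pi_univ, Measure.restrict_univ] at h
  simp only [hRe, lintegral_projectionCorrelation hu hpos] at h
  simpa using h

theorem ae_count_univ_eq (hu : CQuat.IsOrthonormal u μ)
    (hpos : IsPositiveKernel (projectionKernel u)) {P : Measure (PointConfiguration Λ)}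
    (hP : IsPfaffianPointField μ (projectionKernel u) P) :
    ∀ᵐ S ∂P, S.count Set.univ = (N : ℕ∞) := by
  have := hP.isProbabilityMeasure
  have hc : Measurable fun S : PointConfiguration Λ => S.count Set.univ :=
    PointConfiguration.measurable_count MeasurableSet.univ
  have hle : ∀ᵐ S ∂P, S.count Set.univ ≤ (N : ℕ∞) := by
    have h := lintegral_fallingFactorial_count_univ hu hpos hP (Nat.le_add_left 1 N)
    rw [Nat.descFactorial_eq_zero_iff_lt.2 (Nat.lt_succ_self N), Nat.cast_zero] at h
    have h := (lintegral_eq_zero_iff ((measurable_of_countable fun c : ℕ∞ =>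
      ((fallingFactorial c (N + 1) : ℕ∞) : ℝ≥0∞)).comp hc)).1 h
    filter_upwards [h] with S hS
    have hS : fallingFactorial (S.count Set.univ) (N + 1) = 0 := by simpa using hS
    obtain ⟨j, hj, h0⟩ := Finset.prod_eq_zero_iff.1 hS
    refine (tsub_eq_zero_iff_le.1 h0).trans ?_
    exact_mod_cast Nat.lt_succ_iff.1 (Finset.mem_range.1 hj)
  have hmean : ∫⁻ S, ((S.count Set.univ : ℕ∞) : ℝ≥0∞) ∂P = N := by
    have h := lintegral_fallingFactorial_count_univ hu hpos hP le_rfl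
    simpa [fallingFactorial] using h
  have hcE : Measurable fun S : PointConfiguration Λ => ((S.count Set.univ : ℕ∞) : ℝ≥0∞) :=
    (measurable_of_countable fun c : ℕ∞ => (c : ℝ≥0∞)).comp hc
  have hle' : (fun S : PointConfiguration Λ => ((S.count Set.univ : ℕ∞) : ℝ≥0∞)) ≤ᵐ[P]
      fun _ => (N : ℝ≥0∞) := by
    filter_upwards [hle] with S hS
    exact_mod_cast hS
  -- A count bounded by `N` whose mean is `N` equals `N` almost surely, as `P` has mass one.
  have heq := ae_eq_of_ae_le_of_lintegral_le hle' (by rw [hmean]; exact ENNReal.natCast_ne_top N)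
    aemeasurable_const (by rw [hmean]; simp)
  filter_upwards [heq] with S hS
  exact_mod_cast hS

end NumberOfPoints

theorem mainTheorem9 {Λ : Type*} [MeasurableSpace Λ] (μ : Measure Λ) [SigmaFinite μ]
    (N : ℕ) (u : Fin N → Λ → CQuat) (hu : CQuat.IsOrthonormal u μ)
    (hpos : IsPositiveKernel (projectionKernel u)) :
    (∃ P : Measure (PointConfiguration Λ), IsPfaffianPointField μ (projectionKernel u) P) ∧
      ∀ P : Measure (PointConfiguration Λ), IsPfaffianPointField μ (projectionKernel u) P →
        ∀ᵐ S ∂P, S.count Set.univ = (N : ℕ∞) :=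
  ⟨⟨projectionPointField u μ, isPfaffianPointField_projectionPointField hu hpos⟩,
    fun _ hP => ae_count_univ_eq hu hpos hP⟩
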